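/- Let $m\ge 1$ and let $\Omega_{1,1},\dots,\Omega_{1,m},\Omega_{2,1},\dots,\Omega_{2,m}\subset\mathbb C$ be pairwise disjoint sets which are either all finite unions of (oriented, piecewise $C^1$) contours, with $d\mu=dz$, or all discrete sets, with $\mu$ the counting measure. Put $\Omega_\ell=\bigcup_j\Omega_{\ell,j}$ and $\Omega=\Omega_1\cup\Omega_2$; $L^2(\Omega,d\mu)$ is the $L^2$ space of arc length, respectively counting measure, and integral operators on it are taken against $d\mu$. Let $A_j,B_j,\mathsf m_j$ ($1\le j\le m$) and $c$ be measurable complex functions on $\Omega$, with all $\mathsf m_j$ and $c$ non-vanishing, and let $(M_1,\dots,M_m)=\big(\mathsf m_1,\tfrac{\mathsf m_1}{\mathsf m_2},\tfrac{\mathsf m_3}{\mathsf m_2},\tfrac{\mathsf m_3}{\mathsf m_4},\dots\big)$. Let $\widehat K_1$ (from functions on $\Omega_2$ to functions on $\Omega_1$) and $\widehat K_2$ (from functions on $\Omega_1$ to functions on $\Omega_2$) have the kernels $$\widehat K_1(u,v)=\big(\delta_i(j)+\delta_i(j+(-1)^i)\big)\frac{M_i(u)A_i(u)B_j(v)}{u-v},\qquad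 u\in\Omega_{1,i},\ v\in\Omega_{2,j},$$ $$\widehat K_2(u,v)=\big(\delta_i(j)+\delta_i(j-(-1)^i)\big)\frac{M_i(u)^{-1}A_i(u)B_j(v)}{u-v},\qquad u\in\Omega_{2,i},\ v\in\Omega_{1,j},$$ where $\delta_i(j)=1$ if $i=j$ and $0$ otherwise. Let $U=\begin{pmatrix}1&1\\0&0\end{pmatrix}$. Define the $m\times m$ matrices $\Lambda_1=\mathrm{diag}(U,\dots,U)$ for $m$ even and $\mathrm{diag}(U,\dots,U,1)$ for $m$ odd; $\Lambda_2=\mathrm{diag}(1,U,\dots,U,1)$ for $m$ even and $\mathrm{diag}(1,U,\dots,U)$ for $m$ odd; $E_{11}=\mathrm{diag}(1,0,\dots,0)$; and the $(m+1)\times 2m$ matrix $P=(I_{m+1}\ \ 0)$. With $\mathbf A=\mathrm{diag}(A_j)$, $\mathbf B=\mathrm{diag}(B_j)$, $\chi_\ell=\mathrm{diag}(\mathbf 1_{\Omega_{\ell,j}})$ and $e=(1,\dots,1)^T\in\mathbb R^m$, put $$F=P\begin{pmatrix}\Lambda_1&\Lambda_2-E_{11}\\0&E_{11}\end{pmatrix}\begin{pmatrix}\mathbf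 A\chi_1e\\ \mathbf A\chi_2e\end{pmatrix},\qquad G=P\begin{pmatrix}\Lambda_1&\Lambda_2-E_{11}\\0&E_{11}\end{pmatrix}\begin{pmatrix}\mathbf B\chi_2e\\ \mathbf B\chi_1e\end{pmatrix},$$ $\Delta=\mathrm{diag}(\mathsf m_1,\dots,\mathsf m_m,1)$, $f=c\,\Delta F$ and $g=c^{-1}\Delta^{-1}G$, which are functions $\Omega\to\mathbb C^{m+1}$. Let $H$ be the integral operator on $L^2(\Omega,d\mu)$ with kernel $H(u,v)=\dfrac{f(u)^Tg(v)}{u-v}$ for $u\ne v$ and $H(u,u)=0$. If the Fredholm series $$\det(I-\widehat K_1\widehat K_2)=\sum_{n\ge0}\frac{(-1)^n}{n!}\int_{\Omega_1^n}\det\big[(\widehat K_1\widehat K_2)(x_i,x_j)\big]_{i,j=1}^n\,d\mu(x_1)\cdots d\mu(x_n)$$ is well defined (absolutely convergent integrals and absolutely convergent series), where $(\widehat K_1\widehat K_2)(u,w)=\int_{\Omega_2}\widehat K_1(u,v)\widehat K_2(v,w)\,d\mu(v)$, and if $H$ is a trace class operator, then $$\det(I-\widehat K_1\widehat K_2)=\det(I-H),$$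 where $\det(I-H)=\sum_{k\ge0}(-1)^k\,\mathrm{tr}(\Lambda^kH)$ is the Fredholm determinant of the trace class operator $H$. Furthermore (without these two assumptions), $f_i(z)g_i(z)=0$ for every $z\in\Omega$ and $i\in\{1,\dots,m+1\}$. -/

import Mathlib

open MeasureTheory Set Filter Topology
open scoped ENNReal Matrix

universe uE

/-! ### Trace class operators and their Fredholm determinants -/

section TraceClass

variable {E : Type uE} [NormedAddCommGroup E] [InnerProductSpace ℂ E] [CompleteSpace E]

/-- `T` is a trace class (equivalently, on a Hilbert space, nuclear) operator:
`T = ∑ₙ ⟨aₙ, ·⟩ bₙ` with `∑ₙ ‖aₙ‖ ‖bₙ‖ < ∞`. -/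
def IsTraceClass (T : E →L[ℂ] E) : Prop :=
  ∃ a b : ℕ → E, Summable (fun n => ‖a n‖ * ‖b n‖) ∧
    ∀ x : E, HasSum (fun n => inner ℂ (a n) x • b n) (T x)

open Classical in
/-- The principal minor `det (⟨eᵢ, T eⱼ⟩)_{i, j ∈ s}` of `T` in the Hilbert basis `e`. It is the
diagonal matrix entry of the exterior power `Λ^{|s|} T` at the basis vector `⋀_{i ∈ s} eᵢ`. -/
noncomputable def principalMinor {ι : Type uE} (e : HilbertBasis ι ℂ E) (T : E →L[ℂ] E)
    (s : Finset ι) : ℂ :=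
  (Matrix.of fun i j : s => inner ℂ (e i) (T (e j))).det

/-- `det (1 - T) = d` for the operator-theoretic Fredholm determinant
`det (1 - T) = ∑ₖ (-1)ᵏ tr (Λᵏ T)`: in every Hilbert basis of the space, the series of the signed
principal minors of `T` over all finite sets of basis indices converges (unconditionally) to `d`. -/
def HasFredholmDet (T : E →L[ℂ] E) (d : ℂ) : Prop :=
  ∀ (ι : Type uE) (e : HilbertBasis ι ℂ E),
    HasSum (fun s : Finset ι => (-1 : ℂ) ^ s.card * principalMinor e T s) d

end TraceClass

/-! ### Integral operators and Fredholm series with respect to `dμ = τ dρ`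

Here `ρ` is a positive measure and `τ` a unimodular weight: `τ = 1` and `ρ` the counting measure for
discrete sets, and `τ` the unit tangent and `ρ` the arc length for oriented contours (`dz = τ |dz|`).
The Hilbert space is `L²(ρ)`. -/

section Kernels

/-- `T` is the integral operator on `L²(ρ)` with kernel `K`:
`(T φ)(u) = ∫ K(u, v) φ(v) dμ(v)` for almost every `u`, where `dμ = τ dρ`. -/
def IsIntegralOperator (ρ : Measure ℂ) (τ : ℂ → ℂ) (K : ℂ → ℂ → ℂ)
    (T : Lp ℂ 2 ρ →L[ℂ] Lp ℂ 2 ρ) : Prop :=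
  ∀ φ : Lp ℂ 2 ρ, ∀ᵐ u ∂ρ,
    Integrable (fun v => K u v * φ v * τ v) ρ ∧ T φ u = ∫ v, K u v * φ v * τ v ∂ρ

/-- The kernel `∫ K(u, v) L(v, w) dμ(v)` of the product of two integral operators. -/
noncomputable def compKernel (ρ : Measure ℂ) (τ : ℂ → ℂ) (K L : ℂ → ℂ → ℂ) (u w : ℂ) : ℂ :=
  ∫ v, K u v * L v w * τ v ∂ρ

/-- The integrand `det (K(xᵢ, xⱼ)) ∏ᵢ τ(xᵢ)`, `1 ≤ i, j ≤ n`, of the Fredholm series. -/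
noncomputable def fredholmIntegrand (τ : ℂ → ℂ) (K : ℂ → ℂ → ℂ) (n : ℕ) (x : Fin n → ℂ) : ℂ :=
  (Matrix.of fun i j => K (x i) (x j)).det * ∏ i, τ (x i)

/-- The `n`-th term `((-1)ⁿ / n!) ∫ det (K(xᵢ, xⱼ)) dμ(x₁) ⋯ dμ(xₙ)` of the Fredholm series. -/
noncomputable def fredholmTerm (ρ : Measure ℂ) (τ : ℂ → ℂ) (K : ℂ → ℂ → ℂ) (n : ℕ) : ℂ :=
  (-1 : ℂ) ^ n / (n.factorial : ℂ) *
    ∫ x, fredholmIntegrand τ K n x ∂(Measure.pi fun _ : Fin n => ρ)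

/-- The Fredholm series expansion of `det (1 - K)` is well defined: all its integrals converge
absolutely, and so does the series. -/
def FredholmSeriesWellDefined (ρ : Measure ℂ) (τ : ℂ → ℂ) (K : ℂ → ℂ → ℂ) : Prop :=
  (∀ n, Integrable (fredholmIntegrand τ K n) (Measure.pi fun _ : Fin n => ρ)) ∧
    Summable (fredholmTerm ρ τ K)

/-- The Fredholm series
`det (1 - K) = ∑ₙ ((-1)ⁿ / n!) ∫ det (K(xᵢ, xⱼ)) dμ(x₁) ⋯ dμ(xₙ)`. -/
noncomputable def fredholmSeries (ρ : Measure ℂ) (τ : ℂ → ℂ) (K : ℂ → ℂ → ℂ) : ℂ :=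
  ∑' n, fredholmTerm ρ τ K n

end Kernels

/-! ### Contours -/

/-- `S` is a finite union of regular simple `C¹` arcs (open, closed or half-open, bounded or
unbounded; hence also a finite union of piecewise `C¹` contours, closed or not), and the orientation
of the arcs is given by the unit tangent field `τ`: `γ'(t) = |γ'(t)| τ(γ(t))` for almost every `t`. -/
def IsContourUnion (τ : ℂ → ℂ) (S : Set ℂ) : Prop :=
  ∃ (n : ℕ) (J : Fin n → Set ℝ) (γ : Fin n → ℝ → ℂ),
    (∀ i, (J i).OrdConnected ∧ ContDiffOn ℝ 1 (γ i) (J i) ∧ InjOn (γ i) (J i) ∧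
      (∀ t ∈ J i, derivWithin (γ i) (J i) t ≠ 0) ∧
      ∀ᵐ t ∂(volume.restrict (J i)),
        derivWithin (γ i) (J i) t = (‖derivWithin (γ i) (J i) t‖ : ℂ) * τ (γ i t)) ∧
    S = ⋃ i, γ i '' J i

/-! ### The operators -/

/-- The sets and functions from which the operators are built: `Ω₁ j = Ω_{1,j}`, `Ω₂ j = Ω_{2,j}`,
`A j`, `B j`, the functions `w j` whose ratios enter the kernels (written `𝗆_j` in words below), and
the scalar function `c`. An index `j : Fin m` stands for the index `j + 1 ∈ {1, …, m}`. Only the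
values of the functions on the union of the sets matter. -/
structure BlockData (m : ℕ) where
  /-- the sets `Ω_{1,j}` -/
  Ω₁ : Fin m → Set ℂ
  /-- the sets `Ω_{2,j}` -/
  Ω₂ : Fin m → Set ℂ
  /-- the functions `A_j` -/
  A : Fin m → ℂ → ℂ
  /-- the functions `B_j` -/
  B : Fin m → ℂ → ℂ
  /-- the functions `𝗆_j` -/
  w : Fin m → ℂ → ℂ
  /-- the conjugating scalar function -/
  c : ℂ → ℂ

namespace BlockData

variable {m : ℕ} (D : BlockData m)

/-- `Ω₁ = ⋃ⱼ Ω_{1,j}` -/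
def Omega₁ : Set ℂ := ⋃ j, D.Ω₁ j

/-- `Ω₂ = ⋃ⱼ Ω_{2,j}` -/
def Omega₂ : Set ℂ := ⋃ j, D.Ω₂ j

/-- `Ω = Ω₁ ∪ Ω₂` -/
def Omega : Set ℂ := D.Omega₁ ∪ D.Omega₂

/-- The measure `dμ = τ dρ` is the counting measure, and all sets are discrete. -/
def IsDiscreteSetting (ρ : Measure ℂ) (τ : ℂ → ℂ) : Prop :=
  (∀ j, IsDiscrete (D.Ω₁ j)) ∧ (∀ j, IsDiscrete (D.Ω₂ j)) ∧
    ρ = Measure.count.restrict D.Omega ∧ τ = fun _ => 1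

/-- The measure `dμ = τ dρ` is `dz`, and all sets are finite unions of contours: `ρ` is the arc
length (one-dimensional Hausdorff) measure on the union `Ω`, and `τ` the oriented unit tangent. -/
def IsContourSetting (ρ : Measure ℂ) (τ : ℂ → ℂ) : Prop :=
  Measurable τ ∧ (∀ z, ‖τ z‖ = 1) ∧
    (∀ j, IsContourUnion τ (D.Ω₁ j)) ∧ (∀ j, IsContourUnion τ (D.Ω₂ j)) ∧
    ρ = (Measure.hausdorffMeasure 1).restrict D.Omega

/-- The diagonal entries of
`M(z) = diag (𝗆₁, 𝗆₁ / 𝗆₂, 𝗆₃ / 𝗆₂, 𝗆₃ / 𝗆₄, 𝗆₅ / 𝗆₄, …)`. -/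
noncomputable def M (i : Fin m) (z : ℂ) : ℂ :=
  if (i : ℕ) = 0 then D.w i z
  else if Even ((i : ℕ) + 1) then D.w ⟨(i : ℕ) - 1, by omega⟩ z / D.w i z
  else D.w i z / D.w ⟨(i : ℕ) - 1, by omega⟩ z

/-- Kronecker's `δ_a(b)` -/
def kron (a b : ℤ) : ℂ := if a = b then 1 else 0

open Classical in
/-- The kernel `(δ_i(j) + δ_i(j + (-1)^i)) M_i(u) A_i(u) B_j(v) / (u - v)` for `u ∈ Ω_{1,i}`,
`v ∈ Ω_{2,j}`, with `i, j` counted from `1`. -/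
noncomputable def K₁ (u v : ℂ) : ℂ :=
  ∑ i : Fin m, ∑ j : Fin m,
    if u ∈ D.Ω₁ i ∧ v ∈ D.Ω₂ j then
      (kron ((i : ℤ) + 1) ((j : ℤ) + 1) +
          kron ((i : ℤ) + 1) ((j : ℤ) + 1 + (-1) ^ ((i : ℕ) + 1))) *
        (D.M i u * D.A i u * D.B j v / (u - v))
    else 0

open Classical in
/-- The kernel `(δ_i(j) + δ_i(j - (-1)^i)) M_i(u)⁻¹ A_i(u) B_j(v) / (u - v)` for `u ∈ Ω_{2,i}`,
`v ∈ Ω_{1,j}`, with `i, j` counted from `1`. -/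
noncomputable def K₂ (u v : ℂ) : ℂ :=
  ∑ i : Fin m, ∑ j : Fin m,
    if u ∈ D.Ω₂ i ∧ v ∈ D.Ω₁ j then
      (kron ((i : ℤ) + 1) ((j : ℤ) + 1) +
          kron ((i : ℤ) + 1) ((j : ℤ) + 1 - (-1) ^ ((i : ℕ) + 1))) *
        ((D.M i u)⁻¹ * D.A i u * D.B j v / (u - v))
    else 0

/-- `Λ₁ = diag (U, …, U)` (`m` even) or `diag (U, …, U, 1)` (`m` odd), where `U = !![1, 1; 0, 0]`:
with indices from `1`, each odd row `k` has the entry `1` in the columns `k` and `k + 1`. -/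
def Lam₁ (m : ℕ) : Matrix (Fin m) (Fin m) ℂ :=
  Matrix.of fun i j =>
    if Odd ((i : ℕ) + 1) ∧ ((j : ℕ) = i ∨ (j : ℕ) = i + 1) then 1 else 0

/-- `Λ₂ = diag (1, U, …, U, 1)` (`m` even) or `diag (1, U, …, U)` (`m` odd): with indices from `1`,
the first row is `(1, 0, …, 0)`, and each even row `k` has the entry `1` in the columns `k` and
`k + 1`. -/
def Lam₂ (m : ℕ) : Matrix (Fin m) (Fin m) ℂ :=
  Matrix.of fun i j =>
    if ((i : ℕ) = 0 ∧ (j : ℕ) = 0) ∨ (Even ((i : ℕ) + 1) ∧ ((j : ℕ) = i ∨ (j : ℕ) = i + 1))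
    then 1 else 0

/-- `E₁₁ = diag (1, 0, …, 0)` -/
def E₁₁ (m : ℕ) : Matrix (Fin m) (Fin m) ℂ :=
  Matrix.of fun i j => if (i : ℕ) = 0 ∧ (j : ℕ) = 0 then 1 else 0

/-- The `(m + 1) × 2m` matrix `(I_{m+1}  0)`; the `2m` columns are indexed by `Fin m ⊕ Fin m`. -/
def P (m : ℕ) : Matrix (Fin (m + 1)) (Fin m ⊕ Fin m) ℂ :=
  Matrix.of fun i k =>
    if (i : ℕ) = Sum.elim (fun j : Fin m => (j : ℕ)) (fun j : Fin m => m + (j : ℕ)) k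
    then 1 else 0

/-- The `2m × 2m` matrix with the blocks `Λ₁, Λ₂ - E₁₁; 0, E₁₁`. -/
def L (m : ℕ) : Matrix (Fin m ⊕ Fin m) (Fin m ⊕ Fin m) ℂ :=
  Matrix.fromBlocks (Lam₁ m) (Lam₂ m - E₁₁ m) 0 (E₁₁ m)

/-- `F(z) = P (Λ₁, Λ₂ - E₁₁; 0, E₁₁) (A χ₁ e; A χ₂ e)` -/
noncomputable def F (z : ℂ) : Fin (m + 1) → ℂ :=
  (P m * L m) *ᵥ Sum.elim (fun j => D.A j z * (D.Ω₁ j).indicator 1 z)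
    (fun j => D.A j z * (D.Ω₂ j).indicator 1 z)

/-- `G(z) = P (Λ₁, Λ₂ - E₁₁; 0, E₁₁) (B χ₂ e; B χ₁ e)` -/
noncomputable def G (z : ℂ) : Fin (m + 1) → ℂ :=
  (P m * L m) *ᵥ Sum.elim (fun j => D.B j z * (D.Ω₂ j).indicator 1 z)
    (fun j => D.B j z * (D.Ω₁ j).indicator 1 z)

/-- `Δ(z) = diag (𝗆₁(z), …, 𝗆ₘ(z), 1)` -/
def Delta (z : ℂ) : Matrix (Fin (m + 1)) (Fin (m + 1)) ℂ :=
  Matrix.diagonal (Fin.snoc (α := fun _ => ℂ) (fun j : Fin m => D.w j z) 1)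

/-- `f = c Δ F` -/
noncomputable def f (z : ℂ) : Fin (m + 1) → ℂ := D.c z • (D.Delta z *ᵥ D.F z)

/-- `g = c⁻¹ Δ⁻¹ G` -/
noncomputable def g (z : ℂ) : Fin (m + 1) → ℂ := (D.c z)⁻¹ • ((D.Delta z)⁻¹ *ᵥ D.G z)

open Classical in
/-- The kernel `f(u)ᵀ g(v) / (u - v)` for `u ≠ v`, and `0` for `u = v`. -/
noncomputable def H (u v : ℂ) : ℂ :=
  if u = v then 0 else (D.f u ⬝ᵥ D.g v) / (u - v)

end BlockData

/-! At each point of Ω both f and g are multiples of a single unit vector, because every column of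
`P m * L m` is a unit vector (`P_mul_L_inl`, `P_mul_L_inr`). On Ω₁ the row of f is some `rowOdd i`
and that of g some `rowEven i`; on Ω₂ the roles are exchanged. The two kinds of rows never meet, so
f_k g_k = 0, and H vanishes on Ω₁ × Ω₁ and on Ω₂ × Ω₂. Its other two blocks are p K₁ / q and q K₂ /
p for non-vanishing functions p and q (`exists_conjugation`). Formally det(1 - H) = det(1 - H₁₂H₂₁)
= det(1 - K₁K₂).

Two points make this rigorous. First, the determinant of a nuclear operator T = ∑ ⟨aₙ, ·⟩ bₙ is
computed as `fredholmSum a b`, a series of Gram determinants det ⟨a_{νᵢ}, b_{νⱼ}⟩. Hadamard's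
inequality supplies the bounds, and compression to finite parts of a Hilbert basis identifies this
sum with the sum of the signed principal minors in every basis (`hasFredholmDet_fredholmSum`). In a
basis adapted to Ω₁ ∪ Ω₂ the block determinant formula applies to each compression, and the limit
replaces bₙ by χ₁Tχ₂bₙ (`fredholmSum_off_diagonal`).

Second, the Fredholm series integrates the composed kernel on the diagonal, a null set for a
continuous measure, so almost everywhere equality of kernels is not enough. With ∑ ‖aₙ‖² and ∑ ‖bₙ‖²
finite, composition with the intermediate integration makes the kernel of Tχ₂T equal to ∑ (Tχ₂bₙ)(u)
conj aₙ(w) for all u and w in one set of full measure, diagonal included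
(`exists_hasSum_compKernel`). Andréief's identity then turns the integrals of the Fredholm series
into the same Gram determinants. -/

/-! ### Determinants: Hadamard's inequality and principal minors -/

section Determinants

variable {E : Type*} [NormedAddCommGroup E] [InnerProductSpace ℂ E]

/-- Hadamard's inequality for the determinant with respect to an orthonormal basis. -/
theorem OrthonormalBasis.norm_det_le {k : ℕ} (u : OrthonormalBasis (Fin k) ℂ E) (f : Fin k → E) :
    ‖u.toBasis.det f‖ ≤ ∏ i, ‖f i‖ := by
  have := u.toBasis.finiteDimensional_of_finite
  have h : Module.finrank ℂ E = Fintype.card (Fin k) := Module.finrank_eq_card_basis u.toBasis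
  set v := InnerProductSpace.gramSchmidtOrthonormalBasis h f
  -- In the Gram–Schmidt basis of f the matrix of f is triangular, with diagonal entries ⟨vᵢ, fᵢ⟩;
  -- the change of basis costs only a unimodular factor.
  rw [AlternatingMap.eq_smul_basis_det v.toBasis u.toBasis.det, AlternatingMap.smul_apply,
    InnerProductSpace.gramSchmidtOrthonormalBasis_det, norm_smul, v.coe_toBasis,
    u.det_to_matrix_orthonormalBasis v, one_mul, norm_prod]
  refine Finset.prod_le_prod (fun _ _ => norm_nonneg _) fun i _ => ?_
  simpa using norm_inner_le_norm (𝕜 := ℂ) (v i) (f i)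

/-- Hadamard's inequality for mixed Gram determinants. -/
theorem norm_det_inner_le {k : ℕ} (a b : Fin k → E) :
    ‖(Matrix.of fun i j => inner ℂ (a i) (b j)).det‖ ≤ (∏ i, ‖a i‖) * ∏ i, ‖b i‖ := by
  by_cases hb : LinearIndependent ℂ b
  · set W := Submodule.span ℂ (range b)
    have hfin : FiniteDimensional ℂ W := FiniteDimensional.span_of_finite ℂ (finite_range b)
    have h : Module.finrank ℂ W = Fintype.card (Fin k) := finrank_span_eq_card hb
    let b' : Fin k → W := fun i => ⟨b i, Submodule.subset_span (mem_range_self i)⟩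
    let a' : Fin k → W := fun i => W.orthogonalProjectionOnto (a i)
    let u := InnerProductSpace.gramSchmidtOrthonormalBasis h b'
    -- Projecting the aᵢ onto the span of b keeps all inner products with the bⱼ, so the Gram matrix
    -- factors into two square coordinate matrices in one orthonormal basis.
    have key : (Matrix.of fun i j => inner ℂ (a i) (b j)) =
        (u.toBasis.toMatrix a')ᴴ * u.toBasis.toMatrix b' := by
      ext i j
      simp only [Matrix.mul_apply, Matrix.of_apply, Matrix.conjTranspose_apply,
        Module.Basis.toMatrix_apply, OrthonormalBasis.coe_toBasis_repr_apply,
        OrthonormalBasis.repr_apply_apply, RCLike.star_def, inner_conj_symm]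
      rw [u.sum_inner_mul_inner, Submodule.inner_orthogonalProjectionOnto_eq_of_mem_right]
    rw [key, Matrix.det_mul, Matrix.det_conjTranspose, norm_mul, norm_star]
    refine mul_le_mul ?_ (u.norm_det_le b') (norm_nonneg _) (by positivity)
    refine (u.norm_det_le a').trans (Finset.prod_le_prod (fun _ _ => norm_nonneg _) fun i _ => ?_)
    exact W.norm_orthogonalProjectionOnto_apply_le (a i)
  · have : (Matrix.of fun i j => inner ℂ (a i) (b j)).det = 0 := by
      obtain ⟨g, hg, i, hi⟩ := Fintype.not_linearIndependent_iff.1 hb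
      refine Matrix.exists_mulVec_eq_zero_iff.1 ⟨g, fun h => hi (congrFun h i), ?_⟩
      ext j
      have : inner ℂ (a j) (∑ i, g i • b i) = 0 := by rw [hg, inner_zero_right]
      simpa [inner_sum, inner_smul_right, Matrix.mulVec, dotProduct, mul_comm] using this
    rw [this, norm_zero]
    positivity

/-- A sum over the finite subsets of a finite type, written as a sum over injective tuples. -/
theorem sum_finset_eq_sum_tuples {κ R : Type*} [Fintype κ] [DecidableEq κ] [Field R] [CharZero R]
    (h : Finset κ → R) (g : (k : ℕ) → (Fin k → κ) → R)
    (hg : ∀ k t, Function.Injective t → g k t = h (Finset.univ.image t))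
    (hg0 : ∀ k t, ¬ Function.Injective t → g k t = 0) :
    ∑ s, h s = ∑ k ∈ Finset.range (Fintype.card κ + 1), ((k.factorial : R)⁻¹ * ∑ t, g k t) := by
  rw [← Finset.powerset_univ, Finset.sum_powerset, Finset.card_univ]
  refine Finset.sum_congr rfl fun k _ => ?_
  have h1 : ∑ t, g k t = ∑ t with Function.Injective t, g k t := by
    rw [Finset.sum_filter_of_ne]
    intro t _ ht
    by_contra hi
    exact ht (hg0 k t hi)
  have h2 : ∀ t ∈ Finset.univ.filter (fun t : Fin k → κ => Function.Injective t),
      Finset.univ.image t ∈ Finset.powersetCard k (Finset.univ : Finset κ) := by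
    intro t ht
    rw [Finset.mem_filter] at ht
    simp [Finset.mem_powersetCard, Finset.card_image_of_injective _ ht.2]
  rw [h1, ← Finset.sum_fiberwise_of_maps_to h2, Finset.mul_sum]
  refine Finset.sum_congr rfl fun s hs => ?_
  have hcard := (Finset.mem_powersetCard.1 hs).2
  have h3 : ∀ t ∈ (Finset.univ.filter (fun t : Fin k → κ => Function.Injective t)).filter
      (fun t => Finset.univ.image t = s), g k t = h s := by
    intro t ht
    simp only [Finset.mem_filter] at ht
    rw [hg k t ht.1.2, ht.2]
  rw [Finset.sum_congr rfl h3, Finset.sum_const, nsmul_eq_mul]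
  have h4 : ((Finset.univ.filter (fun t : Fin k → κ => Function.Injective t)).filter
      (fun t => Finset.univ.image t = s)).card = k.factorial := by
    have : Fintype.card (Fin k ↪ s) = k.factorial := by
      rw [Fintype.card_embedding_eq]; simp [hcard, Nat.descFactorial_self]
    rw [← this, ← Finset.card_univ]
    symm
    refine Finset.card_bij (fun e _ i => (e i : κ)) ?_ ?_ ?_
    · intro e _
      have hinj : Function.Injective fun i => (e i : κ) := Subtype.val_injective.comp e.injective
      simp only [Finset.mem_filter, Finset.mem_univ, true_and]
      refine ⟨hinj, Finset.eq_of_subset_of_card_le ?_ ?_⟩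
      · intro x hx
        obtain ⟨i, -, rfl⟩ := Finset.mem_image.1 hx
        exact (e i).2
      · rw [Finset.card_image_of_injective _ hinj, hcard]; simp
    · intro e _ e' _ h
      ext i
      exact congrFun h i
    · intro t ht
      simp only [Finset.mem_filter, Finset.mem_univ, true_and] at ht
      refine ⟨⟨fun i => ⟨t i, ht.2 ▸ Finset.mem_image_of_mem t (Finset.mem_univ i)⟩, ?_⟩,
        Finset.mem_univ _, rfl⟩
      intro i j hij
      exact ht.1 (Subtype.ext_iff.1 hij)
  rw [h4, ← mul_assoc, inv_mul_cancel₀ (by exact_mod_cast k.factorial_ne_zero), one_mul]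

theorem Matrix.det_submatrix_of_injective {κ R : Type*} [DecidableEq κ] [CommRing R] {k : ℕ}
    (M : Matrix κ κ R) {t : Fin k → κ} (ht : Function.Injective t) :
    (M.submatrix ((↑) : (Finset.univ.image t) → κ) (↑)).det = (M.submatrix t t).det := by
  let e : Fin k ≃ (Finset.univ.image t) := Equiv.ofBijective
    (fun i => ⟨t i, Finset.mem_image_of_mem t (Finset.mem_univ i)⟩)
    ⟨fun i j hij => ht (Subtype.ext_iff.1 hij), fun ⟨x, hx⟩ => by
      obtain ⟨i, -, rfl⟩ := Finset.mem_image.1 hx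
      exact ⟨i, rfl⟩⟩
  rw [← Matrix.det_submatrix_equiv_self e, Matrix.submatrix_submatrix]
  rfl

theorem Matrix.det_submatrix_of_not_injective {κ R : Type*} [CommRing R] {k : ℕ}
    (M : Matrix κ κ R) {t : Fin k → κ} (ht : ¬ Function.Injective t) :
    (M.submatrix t t).det = 0 := by
  simp only [Function.Injective, not_forall] at ht
  obtain ⟨i, j, hij, hne⟩ := ht
  exact Matrix.det_zero_of_row_eq hne (by ext l; simp [hij])

/-- `det (1 - M)` is the sum of the signed principal minors of `M`. -/
theorem Matrix.det_one_sub_eq_sum_minors {κ R : Type*} [Fintype κ] [DecidableEq κ] [CommRing R]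
    (M : Matrix κ κ R) :
    (1 - M).det = ∑ s : Finset κ, (-1) ^ s.card * (M.submatrix ((↑) : s → κ) (↑)).det := by
  -- The determinant is multilinear in the rows: a set s of rows is taken from -M, the others from
  -- the identity.
  let r : κ → κ → R := fun i j => -M i j
  let o : κ → κ → R := fun i j => (1 : Matrix κ κ R) i j
  have h := (Matrix.detRowAlternating (n := κ) (R := R)).map_add_univ r o
  have h1 : (1 - M).det = Matrix.detRowAlternating (r + o) := by
    refine congrArg Matrix.detRowAlternating (funext fun i => funext fun j => ?_)
    exact sub_eq_neg_add _ _
  rw [h1, h]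
  refine Finset.sum_congr rfl fun s _ => ?_
  have h2 : Matrix.detRowAlternating (s.piecewise r o) =
      (Matrix.of (s.piecewise (-M).row (1 : Matrix κ κ R).row)).det := rfl
  rw [h2, Matrix.det_piecewise_one_eq_submatrix_det, Matrix.submatrix_neg, Pi.neg_apply,
    Pi.neg_apply, Matrix.det_neg, Fintype.card_coe]

end Determinants

/-! ### Andréief's identity and Fredholm integrals of kernels of nuclear type -/

section Andreief

/-- Absolute summability is part of the induction, since each multiplication of two series consumes
it for both factors. -/
theorem hasSum_prod_fin {R : Type*} [NormedCommRing R] [CompleteSpace R] {k : ℕ}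
    (f : Fin k → ℕ → R) (hf : ∀ i, Summable fun n => ‖f i n‖) :
    (Summable fun ν : Fin k → ℕ => ‖∏ i, f i (ν i)‖) ∧
      HasSum (fun ν : Fin k → ℕ => ∏ i, f i (ν i)) (∏ i, ∑' n, f i n) := by
  induction k with
  | zero =>
    refine ⟨(hasSum_fintype _).summable, ?_⟩
    simp
  | succ k ih =>
    obtain ⟨h1, h2⟩ := ih (fun i => f i.succ) fun i => hf i.succ
    let e : ℕ × (Fin k → ℕ) ≃ (Fin (k + 1) → ℕ) := Fin.consEquiv (fun _ : Fin (k + 1) => ℕ)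
    have he : ∀ p : ℕ × (Fin k → ℕ), ∏ i, f i (e p i) = f 0 p.1 * ∏ i : Fin k, f i.succ (p.2 i) := by
      intro p
      rw [Fin.prod_univ_succ]
      rfl
    constructor
    · refine e.summable_iff.1 (((hf 0).mul_norm h1).congr fun p => ?_)
      rw [Function.comp_apply, he]
    · have h3 : Summable fun p : ℕ × (Fin k → ℕ) =>
          f 0 p.1 * (fun ν : Fin k → ℕ => ∏ i : Fin k, f i.succ (ν i)) p.2 :=
        ((hf 0).mul_norm h1).of_norm
      have h4 := (hf 0).of_norm.hasSum.mul h2 h3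
      rw [Fin.prod_univ_succ]
      refine e.hasSum_iff.1 ?_
      simpa only [Function.comp_def, he] using h4

theorem tsum_prod_pow {r : ℕ → ℝ} (hr : Summable r) (k : ℕ) :
    Summable (fun ν : Fin k → ℕ => ∏ i, r (ν i)) ∧
      ∑' ν : Fin k → ℕ, ∏ i, r (ν i) = (∑' n, r n) ^ k := by
  have := (hasSum_prod_fin (fun (_ : Fin k) n => r n) fun _ => hr.norm).2
  exact ⟨this.summable, by simpa using this.tsum_eq⟩

/-- The Cauchy–Binet expansion of the determinant of a kernel `∑ₙ βₙ(x) αₙ(y)`. -/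
theorem hasSum_det_kernel {X : Type*} {k : ℕ} (α β : ℕ → X → ℂ) (κ : X → X → ℂ) (x : Fin k → X)
    (h : ∀ i j, HasSum (fun n => β n (x i) * α n (x j)) (κ (x i) (x j))) :
    HasSum (fun ν : Fin k → ℕ => (∏ i, β (ν i) (x i)) * (Matrix.of fun i j => α (ν i) (x j)).det)
      (Matrix.of fun i j => κ (x i) (x j)).det := by
  rw [← Matrix.det_transpose, Matrix.det_apply']
  have h1 : ∀ ν : Fin k → ℕ, (∏ i, β (ν i) (x i)) * (Matrix.of fun i j => α (ν i) (x j)).det =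
      ∑ σ : Equiv.Perm (Fin k), ((Equiv.Perm.sign σ : ℤ) : ℂ) *
        ∏ i, β (ν i) (x i) * α (ν i) (x (σ i)) := by
    intro ν
    rw [← Matrix.det_transpose, Matrix.det_apply', Finset.mul_sum]
    refine Finset.sum_congr rfl fun σ _ => ?_
    simp only [Matrix.transpose_apply, Matrix.of_apply, Finset.prod_mul_distrib]
    ring
  simp_rw [h1]
  refine hasSum_sum fun σ _ => HasSum.mul_left _ ?_
  have h2 := (hasSum_prod_fin (fun i n => β n (x i) * α n (x (σ i)))
    fun i => (h i (σ i)).summable.norm).2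
  simpa only [(h _ _).tsum_eq, Matrix.transpose_apply, Matrix.of_apply] using h2

section Measure

variable {X : Type*} [MeasurableSpace X] {μ : Measure X} [SigmaFinite μ]

/-- Andréief's identity. -/
theorem integral_prod_mul_det {k : ℕ} (φ ψ : Fin k → X → ℂ)
    (h : ∀ i j, Integrable (fun x => φ i x * ψ j x) μ) :
    Integrable (fun x : Fin k → X => (∏ i, φ i (x i)) * (Matrix.of fun i j => ψ i (x j)).det)
        (Measure.pi fun _ => μ) ∧
      ∫ x, (∏ i, φ i (x i)) * (Matrix.of fun i j => ψ i (x j)).det ∂(Measure.pi fun _ => μ) =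
        (Matrix.of fun i j => ∫ x, φ j x * ψ i x ∂μ).det := by
  have h1 : ∀ x : Fin k → X, (∏ i, φ i (x i)) * (Matrix.of fun i j => ψ i (x j)).det =
      ∑ σ : Equiv.Perm (Fin k), ((Equiv.Perm.sign σ : ℤ) : ℂ) *
        ∏ i, φ i (x i) * ψ (σ i) (x i) := by
    intro x
    rw [Matrix.det_apply', Finset.mul_sum]
    refine Finset.sum_congr rfl fun σ _ => ?_
    simp only [Matrix.of_apply, Finset.prod_mul_distrib]
    ring
  have h2 : ∀ σ : Equiv.Perm (Fin k), Integrable (fun x : Fin k → X =>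
      ((Equiv.Perm.sign σ : ℤ) : ℂ) * ∏ i, φ i (x i) * ψ (σ i) (x i)) (Measure.pi fun _ => μ) :=
    fun σ => (Integrable.fintype_prod (f := fun i x => φ i x * ψ (σ i) x)
      fun i => h i (σ i)).const_mul _
  simp_rw [h1]
  refine ⟨integrable_finsetSum _ fun σ _ => h2 σ, ?_⟩
  rw [integral_finsetSum _ fun σ _ => h2 σ, Matrix.det_apply']
  refine Finset.sum_congr rfl fun σ _ => ?_
  rw [integral_const_mul, integral_fintype_prod_eq_prod (f := fun i x => φ i x * ψ (σ i) x)]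
  rfl

/-- The triangle inequality in the Leibniz expansion. The factor k! is harmless: k stays fixed, and
the bound serves only to exchange the sum over ν with the integral. -/
theorem integral_norm_prod_mul_det_le {k : ℕ} (φ ψ : Fin k → X → ℂ) (p q : Fin k → ℝ)
    (h : ∀ i j, Integrable (fun x => φ i x * ψ j x) μ)
    (hpq : ∀ i j, ∫ x, ‖φ i x * ψ j x‖ ∂μ ≤ p i * q j) :
    ∫ x, ‖(∏ i, φ i (x i)) * (Matrix.of fun i j => ψ i (x j)).det‖ ∂(Measure.pi fun _ => μ) ≤
      k.factorial * ∏ i, (p i * q i) := by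
  have h2 : ∀ σ : Equiv.Perm (Fin k), Integrable (fun x : Fin k → X =>
      ∏ i, ‖φ i (x i) * ψ (σ i) (x i)‖) (Measure.pi fun _ => μ) :=
    fun σ => Integrable.fintype_prod (f := fun i x => ‖φ i x * ψ (σ i) x‖)
      fun i => (h i (σ i)).norm
  calc _ ≤ ∫ x : Fin k → X, ∑ σ : Equiv.Perm (Fin k), ∏ i, ‖φ i (x i) * ψ (σ i) (x i)‖
        ∂(Measure.pi fun _ => μ) := by
        refine integral_mono_of_nonneg (.of_forall fun _ => norm_nonneg _)
          (integrable_finsetSum _ fun σ _ => h2 σ) (.of_forall fun x => ?_)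
        dsimp only
        rw [Matrix.det_apply', Finset.mul_sum]
        refine (norm_sum_le _ _).trans (Finset.sum_le_sum fun σ _ => ?_)
        rw [norm_mul, norm_mul]
        have : ‖((Equiv.Perm.sign σ : ℤ) : ℂ)‖ = 1 := by
          rcases Int.units_eq_one_or (Equiv.Perm.sign σ) with h | h <;> simp [h]
        simp only [this, Finset.prod_mul_distrib, norm_prod, norm_mul, one_mul, Matrix.of_apply,
          le_refl]
    _ = ∑ σ : Equiv.Perm (Fin k), ∏ i, ∫ x, ‖φ i x * ψ (σ i) x‖ ∂μ := by
        rw [integral_finsetSum _ fun σ _ => h2 σ]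
        exact Finset.sum_congr rfl fun σ _ =>
          integral_fintype_prod_eq_prod (f := fun i x => ‖φ i x * ψ (σ i) x‖)
    _ ≤ ∑ σ : Equiv.Perm (Fin k), ∏ i, (p i * q i) := by
        refine Finset.sum_le_sum fun σ _ => ?_
        refine (Finset.prod_le_prod (fun i _ => integral_nonneg fun _ => norm_nonneg _)
          fun i _ => hpq i (σ i)).trans_eq ?_
        rw [Finset.prod_mul_distrib, Finset.prod_mul_distrib, Equiv.prod_comp σ q]
    _ = _ := by simp [Fintype.card_perm]

/-- The Fredholm integrals of a kernel `∑ₙ βₙ(x) αₙ(y)` of nuclear type. -/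
theorem integral_det_kernel {k : ℕ} (α β : ℕ → X → ℂ) (κ : X → X → ℂ) (p q : ℕ → ℝ)
    (hpqs : Summable fun n => p n * q n)
    (hint : ∀ n m, Integrable (fun x => β n x * α m x) μ)
    (hpq : ∀ n m, ∫ x, ‖β n x * α m x‖ ∂μ ≤ p n * q m)
    (S : Set X) (hS : ∀ᵐ x ∂μ, x ∈ S)
    (h : ∀ x ∈ S, ∀ y ∈ S, HasSum (fun n => β n x * α n y) (κ x y)) :
    ∫ x, (Matrix.of fun i j => κ (x i) (x j)).det ∂(Measure.pi fun _ : Fin k => μ) =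
      ∑' ν : Fin k → ℕ, (Matrix.of fun i j => ∫ x, β (ν j) x * α (ν i) x ∂μ).det := by
  -- Almost every tuple has all its coordinates in S, so the expansion of κ on S × S covers the
  -- diagonal entries κ(xᵢ, xᵢ) as well.
  have hS' : ∀ᵐ x ∂(Measure.pi fun _ : Fin k => μ), ∀ i, x i ∈ S :=
    ae_all_iff.2 fun i => (Measure.quasiMeasurePreserving_eval _ i).ae hS
  have hA := fun ν : Fin k → ℕ => integral_prod_mul_det (fun i => β (ν i)) (fun i => α (ν i))
    fun i j => hint (ν i) (ν j)
  have hB := fun ν : Fin k → ℕ => integral_norm_prod_mul_det_le (fun i => β (ν i))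
    (fun i => α (ν i)) (fun i => p (ν i)) (fun i => q (ν i)) (fun i j => hint (ν i) (ν j))
    fun i j => hpq (ν i) (ν j)
  have hsum : Summable fun ν : Fin k → ℕ => (k.factorial : ℝ) * ∏ i, (p (ν i) * q (ν i)) := by
    refine Summable.mul_left _ (hasSum_prod_fin (fun (_ : Fin k) n => p n * q n) fun _ => ?_).2.summable
    exact hpqs.norm
  have key := hasSum_integral_of_summable_integral_norm (fun ν => (hA ν).1)
    (hsum.of_nonneg_of_le (fun ν => integral_nonneg fun _ => norm_nonneg _) hB)
  simp only [(hA _).2] at key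
  rw [key.tsum_eq]
  refine integral_congr_ae (hS'.mono fun x hx => ?_)
  exact (hasSum_det_kernel α β κ x fun i j => h _ (hx i) _ (hx j)).tsum_eq.symm

end Measure

/-! ### Finite compressions and the sums of their minors -/

section Finite

variable {κ : Type*} [Fintype κ]

/-- Andréief's identity for the counting measure on a finite type. -/
theorem sum_prod_mul_det {k : ℕ} (φ ψ : Fin k → κ → ℂ) :
    ∑ t : Fin k → κ, (∏ i, φ i (t i)) * (Matrix.of fun i j => ψ i (t j)).det =
      (Matrix.of fun i j => ∑ x, φ j x * ψ i x).det := by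
  classical
  have h1 : ∀ t : Fin k → κ, (∏ i, φ i (t i)) * (Matrix.of fun i j => ψ i (t j)).det =
      ∑ σ : Equiv.Perm (Fin k), ((Equiv.Perm.sign σ : ℤ) : ℂ) *
        ∏ i, φ i (t i) * ψ (σ i) (t i) := by
    intro x
    rw [Matrix.det_apply', Finset.mul_sum]
    refine Finset.sum_congr rfl fun σ _ => ?_
    simp only [Matrix.of_apply, Finset.prod_mul_distrib]
    ring
  simp_rw [h1]
  rw [Finset.sum_comm, Matrix.det_apply']
  refine Finset.sum_congr rfl fun σ _ => ?_
  simp only [Matrix.of_apply]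
  rw [← Finset.mul_sum, Finset.prod_univ_sum, Fintype.piFinset_univ]

variable {E : Type*} [NormedAddCommGroup E] [InnerProductSpace ℂ E]

/-- The orthogonal projection onto the span of an orthonormal family. -/
noncomputable def orthonormalProj (v : κ → E) (x : E) : E := ∑ i, inner ℂ (v i) x • v i

theorem inner_orthonormalProj (v : κ → E) (x y : E) :
    inner ℂ x (orthonormalProj v y) = ∑ i, inner ℂ (v i) y * inner ℂ x (v i) := by
  simp only [orthonormalProj, inner_sum, inner_smul_right]

theorem norm_orthonormalProj_le {v : κ → E} (hv : Orthonormal ℂ v) (x : E) :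
    ‖orthonormalProj v x‖ ≤ ‖x‖ := by
  have h1 : ‖orthonormalProj v x‖ ^ 2 = ∑ i, ‖inner ℂ (v i) x‖ ^ 2 := by
    have := hv.inner_sum (fun i => inner ℂ (v i) x) (fun i => inner ℂ (v i) x) Finset.univ
    rw [← @inner_self_eq_norm_sq ℂ]
    simp only [orthonormalProj]
    rw [this, map_sum]
    refine Finset.sum_congr rfl fun i _ => ?_
    rw [RCLike.conj_mul, ← RCLike.ofReal_pow]
    exact RCLike.ofReal_re _
  have h2 := hv.sum_inner_products_le x (s := Finset.univ)
  rw [← h1] at h2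
  exact le_of_sq_le_sq h2 (norm_nonneg _)

/-- The tuples of coordinates with respect to an orthonormal family satisfy Hadamard's
inequality in the mean square. -/
theorem sum_norm_det_sq_le {v : κ → E} (hv : Orthonormal ℂ v) {k : ℕ} (a : Fin k → E) :
    ∑ t : Fin k → κ, ‖(Matrix.of fun i j => inner ℂ (a i) (v (t j))).det‖ ^ 2 ≤
      k.factorial * (∏ i, ‖a i‖) ^ 2 := by
  -- In |det|² = conj(det) · det only the first factor is expanded over permutations. Andréief's
  -- identity turns each resulting sum over tuples into a mixed Gram determinant, to which
  -- Hadamard's inequality applies.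
  have h1 : ∀ t : Fin k → κ,
      ((‖(Matrix.of fun i j => inner ℂ (a i) (v (t j))).det‖ ^ 2 : ℝ) : ℂ) =
      ∑ σ : Equiv.Perm (Fin k), ((Equiv.Perm.sign σ : ℤ) : ℂ) *
        ((∏ i, inner ℂ (v (t i)) (a (σ i))) *
          (Matrix.of fun i j => inner ℂ (a i) (v (t j))).det) := by
    intro t
    rw [Complex.ofReal_pow, ← Complex.conj_mul']
    conv_lhs => enter [1]; rw [Matrix.det_apply']
    rw [map_sum, Finset.sum_mul]
    refine Finset.sum_congr rfl fun σ _ => ?_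
    simp only [map_mul, map_prod, Matrix.of_apply, inner_conj_symm, map_intCast]
    ring
  have h2 : ∀ σ : Equiv.Perm (Fin k), ∑ t : Fin k → κ,
      (∏ i, inner ℂ (v (t i)) (a (σ i))) * (Matrix.of fun i j => inner ℂ (a i) (v (t j))).det =
      (Matrix.of fun i j => inner ℂ (a i) (orthonormalProj v (a (σ j)))).det := by
    intro σ
    simp only [inner_orthonormalProj]
    exact sum_prod_mul_det (fun i x => inner ℂ (v x) (a (σ i))) fun i x => inner ℂ (a i) (v x)
  have h3 : ((∑ t : Fin k → κ,
      ‖(Matrix.of fun i j => inner ℂ (a i) (v (t j))).det‖ ^ 2 : ℝ) : ℂ) =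
      ∑ σ : Equiv.Perm (Fin k), ((Equiv.Perm.sign σ : ℤ) : ℂ) *
        (Matrix.of fun i j => inner ℂ (a i) (orthonormalProj v (a (σ j)))).det := by
    rw [Complex.ofReal_sum]
    simp_rw [h1]
    rw [Finset.sum_comm]
    simp_rw [← Finset.mul_sum, h2]
  have h4 : ∀ σ : Equiv.Perm (Fin k), ‖((Equiv.Perm.sign σ : ℤ) : ℂ) *
        (Matrix.of fun i j => inner ℂ (a i) (orthonormalProj v (a (σ j)))).det‖ ≤
      (∏ i, ‖a i‖) ^ 2 := by
    intro σ
    have : ‖((Equiv.Perm.sign σ : ℤ) : ℂ)‖ = 1 := by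
      rcases Int.units_eq_one_or (Equiv.Perm.sign σ) with h | h <;> simp [h]
    rw [norm_mul, this, one_mul, sq]
    refine (norm_det_inner_le _ _).trans (mul_le_mul_of_nonneg_left ?_ (by positivity))
    refine (Finset.prod_le_prod (fun i _ => norm_nonneg _)
      fun i _ => norm_orthonormalProj_le hv (a (σ i))).trans_eq ?_
    exact Equiv.prod_comp σ fun i => ‖a i‖
  have h5 := congrArg norm h3
  rw [Complex.norm_real, Real.norm_of_nonneg (Finset.sum_nonneg fun _ _ => by positivity)] at h5
  rw [h5]
  refine (norm_sum_le _ _).trans ((Finset.sum_le_sum fun σ _ => h4 σ).trans_eq ?_)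
  simp [Fintype.card_perm]

/-- Cauchy–Schwarz over the tuples: Bessel's inequality bounds the products, the mean square
Hadamard inequality the determinants. The gain of √k! over k! is essential: divided by k!, it leaves
a series that converges for every value of ∑ ‖αₙ‖ ‖βₙ‖. -/
theorem sum_norm_prod_mul_det_le {v : κ → E} (hv : Orthonormal ℂ v) {k : ℕ} (a b : Fin k → E) :
    ∑ t : Fin k → κ, ‖(∏ i, inner ℂ (v (t i)) (b i)) *
        (Matrix.of fun i j => inner ℂ (a i) (v (t j))).det‖ ≤
      √k.factorial * ∏ i, (‖a i‖ * ‖b i‖) := by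
  classical
  simp only [norm_mul, norm_prod]
  refine (Real.sum_mul_le_sqrt_mul_sqrt _ _ _).trans ?_
  have h1 : ∑ t : Fin k → κ, (∏ i, ‖inner ℂ (v (t i)) (b i)‖) ^ 2 ≤ (∏ i, ‖b i‖) ^ 2 := by
    simp only [← Finset.prod_pow]
    have := (Finset.prod_univ_sum (fun _ : Fin k => (Finset.univ : Finset κ))
      fun i x => ‖inner ℂ (v x) (b i)‖ ^ 2).symm
    rw [Fintype.piFinset_univ] at this
    rw [this]
    exact Finset.prod_le_prod (fun i _ => Finset.sum_nonneg fun _ _ => by positivity)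
      fun i _ => hv.sum_inner_products_le (b i)
  have h2 := Real.sqrt_le_sqrt h1
  have h3 := Real.sqrt_le_sqrt (sum_norm_det_sq_le hv a)
  rw [Real.sqrt_sq (by positivity)] at h2
  rw [Real.sqrt_mul (by positivity), Real.sqrt_sq (by positivity)] at h3
  refine (mul_le_mul h2 h3 (Real.sqrt_nonneg _) (by positivity)).trans_eq ?_
  rw [Finset.prod_mul_distrib]
  ring

/-- The sums of the minors of the compression of `∑ₙ ⟨αₙ, ·⟩ βₙ` to a finite orthonormal family. -/
theorem sum_det_compression {v : κ → E} (hv : Orthonormal ℂ v) {α β : ℕ → E}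
    (hs : Summable fun n => ‖α n‖ * ‖β n‖) (M : Matrix κ κ ℂ)
    (hM : ∀ i j, HasSum (fun n => inner ℂ (v i) (β n) * inner ℂ (α n) (v j)) (M i j)) (k : ℕ) :
    ∑ t : Fin k → κ, ‖(M.submatrix t t).det‖ ≤ √k.factorial * (∑' n, ‖α n‖ * ‖β n‖) ^ k ∧
    ∑ t : Fin k → κ, (M.submatrix t t).det =
      ∑' ν : Fin k → ℕ,
        (Matrix.of fun i j => inner ℂ (α (ν i)) (orthonormalProj v (β (ν j)))).det := by
  have h1 : ∀ t : Fin k → κ, HasSum (fun ν : Fin k → ℕ => (∏ i, inner ℂ (v (t i)) (β (ν i))) *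
      (Matrix.of fun i j => inner ℂ (α (ν i)) (v (t j))).det) (M.submatrix t t).det :=
    fun t => hasSum_det_kernel (fun n x => inner ℂ (α n) (v x)) (fun n x => inner ℂ (v x) (β n))
      M t fun i j => hM _ _
  have h2 := tsum_prod_pow hs k
  have h3 : ∀ t : Fin k → κ, Summable fun ν : Fin k → ℕ =>
      ‖(∏ i, inner ℂ (v (t i)) (β (ν i))) *
        (Matrix.of fun i j => inner ℂ (α (ν i)) (v (t j))).det‖ := fun t => (h1 t).summable.norm
  constructor
  · calc _ ≤ ∑ t : Fin k → κ, ∑' ν : Fin k → ℕ, ‖(∏ i, inner ℂ (v (t i)) (β (ν i))) *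
        (Matrix.of fun i j => inner ℂ (α (ν i)) (v (t j))).det‖ := by
          refine Finset.sum_le_sum fun t _ => ?_
          rw [← (h1 t).tsum_eq]
          exact norm_tsum_le_tsum_norm (h3 t)
      _ = ∑' ν : Fin k → ℕ, ∑ t : Fin k → κ, ‖(∏ i, inner ℂ (v (t i)) (β (ν i))) *
        (Matrix.of fun i j => inner ℂ (α (ν i)) (v (t j))).det‖ :=
          (Summable.tsum_finsetSum fun t _ => h3 t).symm
      _ ≤ ∑' ν : Fin k → ℕ, √k.factorial * ∏ i, (‖α (ν i)‖ * ‖β (ν i)‖) :=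
          Summable.tsum_le_tsum (fun ν => sum_norm_prod_mul_det_le hv _ _)
            (summable_sum fun t _ => h3 t) (h2.1.mul_left _)
      _ = _ := by rw [tsum_mul_left, h2.2]
  · have h4 := hasSum_sum (s := Finset.univ) fun t _ => h1 t
    rw [← h4.tsum_eq]
    refine tsum_congr fun ν => ?_
    simp only [inner_orthonormalProj]
    exact sum_prod_mul_det (fun i x => inner ℂ (v x) (β (ν i))) fun i x => inner ℂ (α (ν i)) (v x)

end Finite

end Andreief

/-! ### The Fredholm determinant of a nuclear operator -/

section FredholmSum

variable {E : Type uE} [NormedAddCommGroup E] [InnerProductSpace ℂ E]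

/-- The Fredholm determinant `det (1 - T)` of the nuclear operator `T = ∑ₙ ⟨aₙ, ·⟩ bₙ`. -/
noncomputable def fredholmSum (a b : ℕ → E) : ℂ :=
  ∑' k : ℕ, (-1 : ℂ) ^ k / (k.factorial : ℂ) *
    ∑' ν : Fin k → ℕ, (Matrix.of fun i j => inner ℂ (a (ν i)) (b (ν j))).det

/-- Write |x|ᵏ / √k! as (√2ᵏ |x|ᵏ / √k!) · √2⁻ᵏ and bound the product by half the sum of squares: an
exponential series plus a geometric one. -/
theorem summable_pow_div_sqrt_factorial (x : ℝ) :
    Summable fun k : ℕ => x ^ k / √(k.factorial : ℝ) := by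
  have h1 : Summable fun k : ℕ => (1 / 2 : ℝ) * ((2 * x ^ 2) ^ k / k.factorial) :=
    (Real.summable_pow_div_factorial _).mul_left _
  have h2 : Summable fun k : ℕ => (1 / 2 : ℝ) * (1 / 2 : ℝ) ^ k :=
    summable_geometric_two.mul_left _
  refine Summable.of_norm_bounded (h1.add h2) fun k => ?_
  have hk : (0 : ℝ) < √(k.factorial : ℝ) := Real.sqrt_pos.2 (by exact_mod_cast k.factorial_pos)
  have hsq : (√(k.factorial : ℝ)) ^ 2 = k.factorial := Real.sq_sqrt (by positivity)
  have h3 : (0 : ℝ) < (√2) ^ k := by positivity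
  have h4 : ((√2) ^ k) ^ 2 = 2 ^ k := by rw [← pow_mul, mul_comm k 2, pow_mul, Real.sq_sqrt (by norm_num)]
  set u := (√2) ^ k * |x| ^ k / √(k.factorial : ℝ) with hu
  have hu2 : u ^ 2 = (2 * x ^ 2) ^ k / k.factorial := by
    rw [hu, div_pow, mul_pow, hsq, h4, mul_pow, ← pow_mul, mul_comm k 2, pow_mul, sq_abs]
  have hw2 : (((√2) ^ k)⁻¹) ^ 2 = (1 / 2 : ℝ) ^ k := by rw [inv_pow, h4, one_div, inv_pow]
  have h5 : ‖x ^ k / √(k.factorial : ℝ)‖ = u * ((√2) ^ k)⁻¹ := by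
    rw [norm_div, norm_pow, Real.norm_eq_abs, Real.norm_of_nonneg hk.le, hu]
    field_simp
  rw [h5, ← hu2, ← hw2]
  nlinarith [sq_nonneg (u - ((√2) ^ k)⁻¹)]

theorem norm_det_inner_comp_le {a b : ℕ → E} {q : ℕ → ℝ} (hb : ∀ n, ‖b n‖ ≤ q n) {k : ℕ}
    (ν : Fin k → ℕ) : ‖(Matrix.of fun i j => inner ℂ (a (ν i)) (b (ν j))).det‖ ≤
      ∏ i, (‖a (ν i)‖ * q (ν i)) := by
  refine (norm_det_inner_le _ _).trans ?_
  rw [← Finset.prod_mul_distrib]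
  exact Finset.prod_le_prod (fun i _ => by positivity)
    fun i _ => mul_le_mul_of_nonneg_left (hb _) (norm_nonneg _)

/-- Convergence of the vectors is needed only weakly, against the aₙ: each Gram determinant
converges, and Hadamard's inequality with the norm bounds q gives the majorants for dominated
convergence, first over ν, then over k. -/
theorem tendsto_fredholmSum {γ : Type*} {l : Filter γ} {a : ℕ → E} {b : γ → ℕ → E} {b₀ : ℕ → E}
    {q : ℕ → ℝ} (hq : Summable fun n => ‖a n‖ * q n) (hb : ∀ s n, ‖b s n‖ ≤ q n)
    (h : ∀ n m, Tendsto (fun s => inner ℂ (a n) (b s m)) l (𝓝 (inner ℂ (a n) (b₀ m)))) :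
    Tendsto (fun s => fredholmSum a (b s)) l (𝓝 (fredholmSum a b₀)) := by
  have hq' := fun k => tsum_prod_pow hq k
  refine tendsto_tsum_of_dominated_convergence
    (bound := fun k => (∑' n, ‖a n‖ * q n) ^ k / (k.factorial : ℝ))
    (Real.summable_pow_div_factorial _) (fun k => ?_) (.of_forall fun s k => ?_)
  · refine Tendsto.const_mul _ (tendsto_tsum_of_dominated_convergence (hq' k).1 (fun ν => ?_)
      (.of_forall fun s ν => norm_det_inner_comp_le (hb s) ν))
    have : Continuous fun M : Matrix (Fin k) (Fin k) ℂ => M.det := by fun_prop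
    refine (this.tendsto _).comp ?_
    exact tendsto_pi_nhds.2 fun i => tendsto_pi_nhds.2 fun j => h _ _
  · rw [norm_mul, norm_div, norm_pow, norm_neg, norm_one, one_pow, div_eq_inv_mul, mul_one,
      div_eq_inv_mul]
    have h1 : ‖(k.factorial : ℂ)‖ = k.factorial := by simp
    rw [h1]
    refine mul_le_mul_of_nonneg_left ?_ (by positivity)
    refine (tsum_of_norm_bounded (hq' k).1.hasSum fun ν => norm_det_inner_comp_le (hb s) ν).trans_eq
      (hq' k).2

/-- The signed principal minors of the compression of a nuclear operator to a finite orthonormal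
family. -/
theorem sum_minors_compression {κ : Type*} [Fintype κ] [DecidableEq κ] {v : κ → E}
    (hv : Orthonormal ℂ v) {α β : ℕ → E} (hs : Summable fun n => ‖α n‖ * ‖β n‖) (M : Matrix κ κ ℂ)
    (hM : ∀ i j, HasSum (fun n => inner ℂ (v i) (β n) * inner ℂ (α n) (v j)) (M i j)) :
    (1 - M).det = fredholmSum α (fun n => orthonormalProj v (β n)) ∧
    ∑ s : Finset κ, ‖(M.submatrix ((↑) : s → κ) (↑)).det‖ ≤
      ∑' k : ℕ, (∑' n, ‖α n‖ * ‖β n‖) ^ k / √(k.factorial : ℝ) := by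
  have key := sum_det_compression hv hs M hM
  -- A tuple longer than the size of κ repeats an index, so the infinite series over k is really
  -- finite.
  have hbig : ∀ k ∉ Finset.range (Fintype.card κ + 1), ∀ t : Fin k → κ,
      (M.submatrix t t).det = 0 := by
    intro k hk t
    refine Matrix.det_submatrix_of_not_injective M fun ht => hk ?_
    have := Fintype.card_le_of_injective t ht
    rw [Fintype.card_fin] at this
    exact Finset.mem_range.2 (Nat.lt_succ_of_le this)
  constructor
  · rw [Matrix.det_one_sub_eq_sum_minors, sum_finset_eq_sum_tuples _
      fun k t => (-1) ^ k * (M.submatrix t t).det, fredholmSum, tsum_eq_sum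
      (s := Finset.range (Fintype.card κ + 1))]
    · refine Finset.sum_congr rfl fun k _ => ?_
      rw [← Finset.mul_sum, (key k).2]
      ring
    · intro k hk
      rw [← (key k).2, Finset.sum_eq_zero fun t _ => hbig k hk t, mul_zero]
    · intro k t ht
      rw [M.det_submatrix_of_injective ht, Finset.card_image_of_injective _ ht, Finset.card_univ,
        Fintype.card_fin]
    · intro k t ht
      rw [M.det_submatrix_of_not_injective ht, mul_zero]
  · rw [sum_finset_eq_sum_tuples _ fun k t => ‖(M.submatrix t t).det‖]
    · refine le_trans (Finset.sum_le_sum fun k _ => ?_)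
        ((summable_pow_div_sqrt_factorial _).sum_le_tsum _ fun k _ => ?_)
      · refine (mul_le_mul_of_nonneg_left (key k).1 (by positivity)).trans_eq ?_
        have hk : (0 : ℝ) < √(k.factorial : ℝ) :=
          Real.sqrt_pos.2 (by exact_mod_cast k.factorial_pos)
        have hsq : (k.factorial : ℝ) = (√(k.factorial : ℝ)) ^ 2 :=
          (Real.sq_sqrt (by positivity)).symm
        rw [← mul_assoc, div_eq_inv_mul]
        congr 1
        nth_rewrite 1 [hsq]
        field_simp
      · have : 0 ≤ ∑' n, ‖α n‖ * ‖β n‖ := tsum_nonneg fun n => by positivity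
        positivity
    · intro k t ht
      rw [M.det_submatrix_of_injective ht]
    · intro k t ht
      rw [M.det_submatrix_of_not_injective ht, norm_zero]

theorem hasSum_inner_nuclear {a b : ℕ → E} {T : E → E}
    (hT : ∀ x, HasSum (fun n => inner ℂ (a n) x • b n) (T x)) (x y : E) :
    HasSum (fun n => inner ℂ x (b n) * inner ℂ (a n) y) (inner ℂ x (T y)) := by
  have := (hT y).mapL (innerSL ℂ x)
  simpa only [innerSL_apply_apply, inner_smul_right, mul_comm] using this

theorem Finset.powerset_eq_map_subtype {ι : Type*} (S : Finset ι) :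
    S.powerset = (Finset.univ : Finset (Finset S)).map
      (Finset.mapEmbedding (Function.Embedding.subtype (· ∈ S))).toEmbedding := by
  classical
  ext t
  simp only [Finset.mem_powerset, Finset.mem_map, Finset.mem_univ, true_and,
    RelEmbedding.coe_toEmbedding, Finset.mapEmbedding_apply]
  constructor
  · exact fun h => ⟨t.subtype (· ∈ S), Finset.subtype_map_of_mem h⟩
  · rintro ⟨s, rfl⟩ x hx
    obtain ⟨y, -, rfl⟩ := Finset.mem_map.1 hx
    exact y.2

theorem principalMinor_map_subtype [CompleteSpace E] {ι : Type uE} (e : HilbertBasis ι ℂ E) (T : E →L[ℂ] E)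
    (S : Finset ι) [DecidableEq S] (s : Finset S) :
    principalMinor e T (s.map (Function.Embedding.subtype (· ∈ S))) =
      ((Matrix.of fun i j : S => inner ℂ (e i) (T (e j))).submatrix ((↑) : s → S) (↑)).det := by
  classical
  let f : s ≃ s.map (Function.Embedding.subtype (· ∈ S)) := Equiv.ofBijective
    (fun i => ⟨(i : S), Finset.mem_map_of_mem (Function.Embedding.subtype (· ∈ S)) i.2⟩)
    ⟨fun i j hij => Subtype.ext (Subtype.ext (congrArg
      (fun x : s.map (Function.Embedding.subtype (· ∈ S)) => (x : ι)) hij)), fun ⟨x, hx⟩ => by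
      obtain ⟨i, hi, rfl⟩ := Finset.mem_map.1 hx
      exact ⟨⟨i, hi⟩, rfl⟩⟩
  rw [principalMinor, ← Matrix.det_submatrix_equiv_self f]
  rfl

theorem tendsto_inner_orthonormalProj {ι : Type*} (e : HilbertBasis ι ℂ E) (x y : E) :
    Tendsto (fun S : Finset ι => inner ℂ x (orthonormalProj (fun i : S => e i) y)) atTop
      (𝓝 (inner ℂ x y)) := by
  refine (e.hasSum_inner_mul_inner x y).congr fun S => ?_
  rw [inner_orthonormalProj, Finset.sum_coe_sort S fun i => inner ℂ (e i) y * inner ℂ x (e i)]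
  exact Finset.sum_congr rfl fun i _ => mul_comm _ _

theorem tendsto_det_compression {ι : Type*} (e : HilbertBasis ι ℂ E) {a b : ℕ → E}
    (hs : Summable fun n => ‖a n‖ * ‖b n‖) :
    Tendsto (fun S : Finset ι => fredholmSum a fun n => orthonormalProj (fun i : S => e i) (b n))
      atTop (𝓝 (fredholmSum a b)) :=
  tendsto_fredholmSum hs (fun _ _ => norm_orthonormalProj_le
    (e.orthonormal.comp _ Subtype.val_injective) _) fun _ _ => tendsto_inner_orthonormalProj e _ _

/-- The minors are absolutely summable by a bound uniform in the finite compressions, so the sum may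
be evaluated along the power sets of finite S. There the partial sum is the determinant of the
compression to S, which tends to `fredholmSum a b`. -/
theorem hasFredholmDet_fredholmSum [CompleteSpace E] {T : E →L[ℂ] E} {a b : ℕ → E}
    (hs : Summable fun n => ‖a n‖ * ‖b n‖)
    (hT : ∀ x, HasSum (fun n => inner ℂ (a n) x • b n) (T x)) :
    HasFredholmDet T (fredholmSum a b) := by
  classical
  intro ι e
  have h1 : ∀ S : Finset ι, _ := fun S => sum_minors_compression
    (e.orthonormal.comp ((↑) : S → ι) Subtype.val_injective) hs
    (Matrix.of fun i j : S => inner ℂ (e i) (T (e j))) fun i j => hasSum_inner_nuclear hT _ _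
  have hsum : Summable fun s : Finset ι => (-1 : ℂ) ^ s.card * principalMinor e T s := by
    refine Summable.of_norm ?_
    refine summable_of_sum_le (c := ∑' k : ℕ, (∑' n, ‖a n‖ * ‖b n‖) ^ k / √(k.factorial : ℝ))
      (fun _ => norm_nonneg _) fun U => ?_
    -- Finitely many index sets all lie inside their union, so one compression controls them.
    have hU : U ⊆ (U.sup id).powerset := fun s hs' =>
      Finset.mem_powerset.2 (Finset.le_sup (f := id) hs')
    refine (Finset.sum_le_sum_of_subset_of_nonneg hU fun _ _ _ => norm_nonneg _).trans ?_
    refine le_trans (le_of_eq ?_) (h1 (U.sup id)).2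
    rw [Finset.powerset_eq_map_subtype, Finset.sum_map]
    refine Finset.sum_congr rfl fun s _ => ?_
    rw [norm_mul, norm_pow, norm_neg, norm_one, one_pow, one_mul]
    exact congrArg norm (principalMinor_map_subtype e T _ s)
  have hmono : Tendsto (fun S : Finset ι => S.powerset) atTop atTop :=
    tendsto_atTop_finset_of_monotone (fun _ _ => Finset.powerset_mono.2)
      fun s => ⟨s, Finset.mem_powerset_self s⟩
  have h2 := hsum.hasSum.comp hmono
  have h3 : Tendsto (fun S : Finset ι => ∑ s ∈ S.powerset, (-1 : ℂ) ^ s.card * principalMinor e T s)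
      atTop (𝓝 (fredholmSum a b)) := by
    refine (tendsto_det_compression e hs).congr fun S => ?_
    rw [Finset.powerset_eq_map_subtype, Finset.sum_map]
    refine (h1 S).1.symm.trans ((Matrix.det_one_sub_eq_sum_minors _).trans ?_)
    refine Finset.sum_congr rfl fun s _ => ?_
    congr 1
    · simp
    · exact (principalMinor_map_subtype e T _ s).symm
  rw [← tendsto_nhds_unique h2 h3]
  exact hsum.hasSum

/-! ### Off-diagonal nuclear operators -/

/-- A Hilbert basis adapted to an orthogonal projection. -/
theorem exists_hilbertBasis_adapted [CompleteSpace E] {P : E →L[ℂ] E}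
    (hsymm : ∀ x y, inner ℂ (P x) y = inner ℂ x (P y)) (hidem : ∀ x, P (P x) = P x) :
    ∃ (ι : Type uE) (e : HilbertBasis ι ℂ E), ∀ i, P (e i) = e i ∨ P (e i) = 0 := by
  let K : Submodule ℂ E := LinearMap.ker ((P - ContinuousLinearMap.id ℂ E : E →L[ℂ] E) : E →ₗ[ℂ] E)
  have hK : ∀ x, x ∈ K ↔ P x = x := fun x => by
    simp [K, sub_eq_zero]
  have hKc : IsClosed (K : Set E) := (P - ContinuousLinearMap.id ℂ E).isClosed_ker
  have : CompleteSpace K := hKc.completeSpace_coe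
  obtain ⟨w, b, hb⟩ := exists_hilbertBasis ℂ K
  have hbo : Orthonormal ℂ fun x : w => ((x : K) : E) := by
    have := b.orthonormal
    rw [hb] at this
    exact this.comp_linearIsometry K.subtypeₗᵢ
  have hs : Orthonormal ℂ ((↑) : (range fun x : w => ((x : K) : E)) → E) :=
    hbo.toSubtypeRange
  obtain ⟨w', e, hsub, he⟩ := hs.exists_hilbertBasis_extension
  refine ⟨w', e, fun i => ?_⟩
  by_cases hi : (i : E) ∈ range fun x : w => ((x : K) : E)
  · left
    obtain ⟨x, hx⟩ := hi
    rw [he, ← hx]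
    exact (hK _).1 (x : K).2
  · right
    have horth : ∀ x : w, inner ℂ (i : E) ((x : K) : E) = 0 := by
      intro x
      have hx : ((x : K) : E) ∈ w' := hsub ⟨x, rfl⟩
      have := e.orthonormal.2 (i := i) (j := ⟨_, hx⟩) (fun h => hi ⟨x, by rw [h]⟩)
      simpa [he] using this
    have h0 : ∀ y : K, inner ℂ (i : E) (y : E) = 0 := by
      intro y
      have h1 := ((b.hasSum_repr y).mapL (K.subtypeL)).mapL (innerSL ℂ (i : E))
      have h2 : ∀ j, innerSL ℂ (i : E) (K.subtypeL (b.repr y j • b j)) = 0 := by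
        intro j
        rw [map_smul, map_smul, innerSL_apply_apply, hb, Submodule.subtypeL_apply, horth, smul_zero]
      simp only [h2] at h1
      exact h1.unique hasSum_zero
    -- Orthogonality to the range K of P gives ‖P eᵢ‖² = ⟨eᵢ, P eᵢ⟩ = 0.
    have h3 := h0 ⟨P i, (hK _).2 (hidem _)⟩
    rw [he, ← @inner_self_eq_zero ℂ, hsymm, hidem]
    exact h3

/-- The projections are contractions that converge strongly to the identity, so they may be applied
to a convergent net. -/
theorem tendsto_orthonormalProj_comp {ι : Type*} (e : HilbertBasis ι ℂ E) {y : Finset ι → E} {z : E}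
    (hy : Tendsto y atTop (𝓝 z)) :
    Tendsto (fun S : Finset ι => orthonormalProj (fun i : S => e i) (y S)) atTop (𝓝 z) := by
  have h1 : Tendsto (fun S : Finset ι => orthonormalProj (fun i : S => e i) z) atTop (𝓝 z) := by
    refine (e.hasSum_repr z).congr fun S => ?_
    rw [orthonormalProj, Finset.sum_coe_sort S fun i => inner ℂ (e i) z • e i]
    simp only [e.repr_apply_apply]
  have h2 : Tendsto (fun S : Finset ι => orthonormalProj (fun i : S => e i) (y S - z)) atTop
      (𝓝 0) := by
    refine squeeze_zero_norm (a := fun S => ‖y S - z‖) (fun S => norm_orthonormalProj_le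
      (e.orthonormal.comp _ Subtype.val_injective) _) ?_
    simpa using (hy.sub_const z).norm
  have h3 := h1.add h2
  rw [add_zero] at h3
  refine h3.congr fun S => ?_
  simp [orthonormalProj, sub_smul]

/-- This moves the selection of a subfamily into the vector, as P x or x - P x in an adapted basis,
where the limit over S can be taken. -/
theorem orthonormalProj_subtype {κ : Type*} [Fintype κ] (v : κ → E) (p : κ → Prop)
    [DecidablePred p] (x x' : E) (h : ∀ i, p i → inner ℂ (v i) x' = inner ℂ (v i) x)
    (h' : ∀ i, ¬ p i → inner ℂ (v i) x' = 0) :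
    orthonormalProj (fun i : {i // p i} => v i) x = orthonormalProj v x' := by
  rw [orthonormalProj, orthonormalProj, ← Finset.sum_subtype (Finset.univ.filter p) (by simp)
    fun i => inner ℂ (v i) x • v i, Finset.sum_filter]
  refine Finset.sum_congr rfl fun i _ => ?_
  split_ifs with hi
  · rw [h i hi]
  · rw [h' i hi, zero_smul]

/-- The determinant of an off-diagonal operator, as the determinant of the product of its
corners. -/
theorem fredholmSum_off_diagonal [CompleteSpace E] {P T : E →L[ℂ] E}
    (hsymm : ∀ x y, inner ℂ (P x) y = inner ℂ x (P y)) (hidem : ∀ x, P (P x) = P x)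
    (h11 : ∀ x, P (T (P x)) = 0) (h22 : ∀ x, T (x - P x) = P (T (x - P x)))
    {a b : ℕ → E} (hs : Summable fun n => ‖a n‖ * ‖b n‖)
    (hT : ∀ x, HasSum (fun n => inner ℂ (a n) x • b n) (T x)) :
    fredholmSum a b = fredholmSum a fun n => P (T (b n - P (b n))) := by
  classical
  obtain ⟨ι, e, he⟩ := exists_hilbertBasis_adapted hsymm hidem
  let p : ι → Prop := fun i => P (e i) = e i
  have hp' : ∀ i, ¬ p i → P (e i) = 0 := fun i hi => (he i).resolve_left hi
  have hon : ∀ S : Finset ι, Orthonormal ℂ fun i : S => e i :=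
    fun S => e.orthonormal.comp _ Subtype.val_injective
  let Q : Finset ι → E → E := fun S x =>
    orthonormalProj (fun i : {i : S // p i} => e (i : S)) x
  let R : Finset ι → E → E := fun S x =>
    orthonormalProj (fun i : {i : S // ¬ p i} => e (i : S)) x
  have hQ : ∀ S x, Q S x = orthonormalProj (fun i : S => e i) (P x) := by
    intro S x
    refine orthonormalProj_subtype (fun i : S => e i) _ x (P x) (fun i hi => ?_) fun i hi => ?_
    · rw [← hsymm, show P (e i) = e i from hi]
    · rw [← hsymm, hp' _ hi, inner_zero_left]
  have hR : ∀ S x, R S x = orthonormalProj (fun i : S => e i) (x - P x) := by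
    intro S x
    refine orthonormalProj_subtype (fun i : S => e i) _ x (x - P x) (fun i hi => ?_) fun i hi => ?_
    · rw [inner_sub_right, ← hsymm, hp' _ hi, inner_zero_left, sub_zero]
    · rw [inner_sub_right, ← hsymm, show P (e i) = e i from not_not.1 hi, sub_self]
  have hdet : ∀ S : Finset ι, fredholmSum a (fun n => orthonormalProj (fun i : S => e i) (b n)) =
      fredholmSum a (fun n => Q S (T (R S (b n)))) := by
    intro S
    let M : Matrix S S ℂ := Matrix.of fun i j => inner ℂ (e i) (T (e j))
    rw [← (sum_minors_compression (hon S) hs M fun i j => hasSum_inner_nuclear hT _ _).1]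
    have hblock := Matrix.det_toBlock (1 - M) (fun i : S => p i)
    have hM11 : ∀ i j : S, p i → p j → M i j = 0 := by
      intro i j hi hj
      change inner ℂ (e i) (T (e j)) = 0
      rw [← show P (e i) = e i from hi, ← show P (e j) = e j from hj, hsymm, h11, inner_zero_right]
    have hM22 : ∀ i j : S, ¬ p i → ¬ p j → M i j = 0 := by
      intro i j hi hj
      change inner ℂ (e i) (T (e j)) = 0
      have := h22 (e j)
      rw [hp' _ hj, sub_zero] at this
      rw [this, ← hsymm, hp' _ hi, inner_zero_left]
    let B : Matrix {i : S // p i} {i : S // ¬ p i} ℂ := M.submatrix (↑) (↑)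
    let C : Matrix {i : S // ¬ p i} {i : S // p i} ℂ := M.submatrix (↑) (↑)
    have hb1 : (1 - M).toBlock (fun i : S => p i) (fun i => p i) = 1 := by
      ext i j
      simp [Matrix.toBlock, hM11 i j i.2 j.2, Matrix.one_apply, Subtype.val_inj]
    have hb2 : (1 - M).toBlock (fun i : S => ¬ p i) (fun i => ¬ p i) = 1 := by
      ext i j
      simp [Matrix.toBlock, hM22 i j i.2 j.2, Matrix.one_apply, Subtype.val_inj]
    have hb3 : (1 - M).toBlock (fun i : S => p i) (fun i => ¬ p i) = -B := by
      ext i j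
      have : (i : S) ≠ j := fun h => j.2 (h ▸ i.2)
      simp [Matrix.toBlock, B, this]
    have hb4 : (1 - M).toBlock (fun i : S => ¬ p i) (fun i => p i) = -C := by
      ext i j
      have : (i : S) ≠ j := fun h => i.2 (h ▸ j.2)
      simp [Matrix.toBlock, C, this]
    -- With identity diagonal blocks, det(1 - M) is the determinant of the Schur complement 1 - BC.
    rw [hblock, hb1, hb2, hb3, hb4, Matrix.det_fromBlocks_one₂₂, Matrix.neg_mul, Matrix.mul_neg,
      neg_neg]
    refine (sum_minors_compression ((hon S).comp ((↑) : {i : S // p i} → S) Subtype.val_injective)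
      (α := a) (β := fun n => T (R S (b n))) ?_ (B * C) fun i j => ?_).1
    · refine (hs.mul_left ‖T‖).of_nonneg_of_le (fun n => by positivity) fun n => ?_
      have h1 : ‖T (R S (b n))‖ ≤ ‖T‖ * ‖b n‖ := (T.le_opNorm _).trans (mul_le_mul_of_nonneg_left
        (norm_orthonormalProj_le ((hon S).comp _ Subtype.val_injective) _) (norm_nonneg _))
      calc _ ≤ ‖a n‖ * (‖T‖ * ‖b n‖) := mul_le_mul_of_nonneg_left h1 (norm_nonneg _)
        _ = _ := by ring
    -- Only the factor C is expanded in the nuclear series; B is absorbed into the vectors T(R S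
    -- bₙ), and the aₙ remain unchanged.
    · have h1 : ∀ n, inner ℂ (e (i : S)) (T (R S (b n))) * inner ℂ (a n) (e (j : S)) =
          ∑ l : {i : S // ¬ p i}, inner ℂ (e (i : S)) (T (e (l : S))) *
            (inner ℂ (e (l : S)) (b n) * inner ℂ (a n) (e (j : S))) := by
        intro n
        simp only [R, orthonormalProj, map_sum, map_smul, inner_sum, inner_smul_right,
          Finset.sum_mul]
        exact Finset.sum_congr rfl fun l _ => by ring
      refine HasSum.congr_fun ?_ h1
      rw [Matrix.mul_apply]
      exact hasSum_sum fun l _ => (hasSum_inner_nuclear hT _ _).mul_left _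
  have hlim : Tendsto (fun S : Finset ι => fredholmSum a (fun n => Q S (T (R S (b n))))) atTop
      (𝓝 (fredholmSum a fun n => P (T (b n - P (b n))))) := by
    refine tendsto_fredholmSum (q := fun n => ‖T‖ * ‖b n‖) ?_ (fun S n => ?_) fun n m => ?_
    · refine (hs.mul_left ‖T‖).congr fun n => by ring
    · refine (norm_orthonormalProj_le ((hon S).comp _ Subtype.val_injective) _).trans ?_
      exact (T.le_opNorm _).trans (mul_le_mul_of_nonneg_left
        (norm_orthonormalProj_le ((hon S).comp _ Subtype.val_injective) _) (norm_nonneg _))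
    · refine Tendsto.inner tendsto_const_nhds ?_
      simp only [hQ, hR]
      refine tendsto_orthonormalProj_comp e (((P.comp T).continuous.tendsto _).comp ?_)
      exact tendsto_orthonormalProj_comp e tendsto_const_nhds
  refine tendsto_nhds_unique (tendsto_det_compression e hs) (hlim.congr fun S => (hdet S).symm)

end FredholmSum

/-! ### Integral operators of trace class -/

theorem summable_mul_of_sq {r s : ℕ → ℝ} (hr : Summable fun n => r n ^ 2)
    (hs : Summable fun n => s n ^ 2) : Summable fun n => r n * s n := by
  refine Summable.of_norm_bounded (hr.add hs) fun n => ?_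
  rw [Real.norm_eq_abs, abs_le]
  constructor <;> nlinarith [sq_nonneg (r n + s n), sq_nonneg (r n - s n)]

/-- A trace class operator has a representation by two square summable sequences. -/
theorem IsTraceClass.exists_sq_summable {E : Type uE} [NormedAddCommGroup E]
    [InnerProductSpace ℂ E] [CompleteSpace E] {T : E →L[ℂ] E} (hT : IsTraceClass T) :
    ∃ a b : ℕ → E, (Summable fun n => ‖a n‖ ^ 2) ∧ (Summable fun n => ‖b n‖ ^ 2) ∧
      ∀ x, HasSum (fun n => inner ℂ (a n) x • b n) (T x) := by
  obtain ⟨a, b, hs, h⟩ := hT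
  have key : ∀ x y : E, ∃ x' y' : E, ‖x'‖ ^ 2 = ‖x‖ * ‖y‖ ∧ ‖y'‖ ^ 2 = ‖x‖ * ‖y‖ ∧
      ∀ z, inner ℂ x' z • y' = inner ℂ x z • y := by
    intro x y
    by_cases hx : x = 0
    · exact ⟨0, 0, by simp [hx], by simp [hx], by simp [hx]⟩
    by_cases hy : y = 0
    · exact ⟨0, 0, by simp [hy], by simp [hy], by simp [hy]⟩
    have hx' := norm_pos_iff.2 hx
    have hy' := norm_pos_iff.2 hy
    -- Replacing x, y by t x, t⁻¹ y keeps the rank one operator and makes the norms equal: t² ‖x‖² =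
    -- ‖x‖ ‖y‖.
    set t : ℝ := √(‖y‖ / ‖x‖) with ht
    have ht0 : 0 < t := Real.sqrt_pos.2 (by positivity)
    have ht2 : t ^ 2 = ‖y‖ / ‖x‖ := Real.sq_sqrt (by positivity)
    have htc : (t : ℂ) ≠ 0 := by exact_mod_cast ht0.ne'
    refine ⟨(t : ℂ) • x, (t : ℂ)⁻¹ • y, ?_, ?_, fun z => ?_⟩
    · rw [norm_smul, Complex.norm_real, Real.norm_of_nonneg ht0.le, mul_pow, ht2]
      field_simp
    · rw [norm_smul, norm_inv, Complex.norm_real, Real.norm_of_nonneg ht0.le, mul_pow, inv_pow, ht2]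
      field_simp
    · rw [inner_smul_left, Complex.conj_ofReal, smul_smul, mul_right_comm, mul_inv_cancel₀ htc,
        one_mul]
  choose a' b' ha' hb' hab using key
  refine ⟨fun n => a' (a n) (b n), fun n => b' (a n) (b n), ?_, ?_, fun x => ?_⟩
  · simpa only [ha'] using hs
  · simpa only [hb'] using hs
  · simpa only [hab] using h x

/-! ### Pointwise values and restrictions of square integrable functions -/

section L2

variable {X : Type*} [MeasurableSpace X] {ρ : Measure X}

theorem L2_norm_sq_eq_integral (f : Lp ℂ 2 ρ) : ‖f‖ ^ 2 = ∫ x, ‖f x‖ ^ 2 ∂ρ := by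
  have h := L2.inner_def (𝕜 := ℂ) f f
  rw [inner_self_eq_norm_sq_to_K] at h
  have h2 : ∀ x, inner ℂ (f x) (f x) = ((‖f x‖ ^ 2 : ℝ) : ℂ) := fun x => by
    rw [inner_self_eq_norm_sq_to_K]; norm_cast
  simp only [h2, integral_complex_ofReal] at h
  exact Complex.ofReal_injective (by simpa using h)

theorem L2_integral_norm_mul_le (f g : Lp ℂ 2 ρ) : ∫ x, ‖f x‖ * ‖g x‖ ∂ρ ≤ ‖f‖ * ‖g‖ := by
  have hf : MemLp f (ENNReal.ofReal 2) ρ := by simpa using Lp.memLp f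
  have hg : MemLp g (ENNReal.ofReal 2) ρ := by simpa using Lp.memLp g
  have h := integral_mul_norm_le_Lp_mul_Lq Real.HolderConjugate.two_two hf hg
  simp only [Real.rpow_two, ← L2_norm_sq_eq_integral, ← Real.sqrt_eq_rpow,
    Real.sqrt_sq (norm_nonneg _)] at h
  exact h

/-- By Tonelli for ∑ |xₙ(u)|². It lets the values at a point u serve as square summable
coefficients. -/
theorem ae_summable_sq {x : ℕ → Lp ℂ 2 ρ} (hx : Summable fun n => ‖x n‖ ^ 2) :
    ∀ᵐ u ∂ρ, Summable fun n => ‖x n u‖ ^ 2 := by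
  have hm : ∀ n, AEMeasurable (fun u => ENNReal.ofReal (‖x n u‖ ^ 2)) ρ := fun n =>
    ((Lp.aestronglyMeasurable (x n)).norm.aemeasurable.pow_const 2).ennreal_ofReal
  have hint : ∀ n, ∫⁻ u, ENNReal.ofReal (‖x n u‖ ^ 2) ∂ρ = ENNReal.ofReal (‖x n‖ ^ 2) := by
    intro n
    rw [L2_norm_sq_eq_integral, ofReal_integral_eq_lintegral_ofReal
      ((Lp.memLp (x n)).integrable_norm_pow (by norm_num)) (.of_forall fun _ => by positivity)]
  have h1 : ∫⁻ u, ∑' n, ENNReal.ofReal (‖x n u‖ ^ 2) ∂ρ ≠ ∞ := by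
    rw [lintegral_tsum hm]
    simp only [hint]
    exact hx.tsum_ofReal_ne_top
  filter_upwards [ae_lt_top' (AEMeasurable.tsum hm) h1] with u hu
  refine (ENNReal.summable_toReal hu.ne).congr fun n => ?_
  rw [ENNReal.toReal_ofReal (by positivity)]

theorem ae_hasSum_coeFn {r : ℕ → ℂ} {x : ℕ → Lp ℂ 2 ρ} {y : Lp ℂ 2 ρ}
    (hr : Summable fun n => ‖r n‖ ^ 2) (hx : Summable fun n => ‖x n‖ ^ 2)
    (hy : HasSum (fun n => r n • x n) y) : ∀ᵐ u ∂ρ, HasSum (fun n => r n * x n u) (y u) := by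
  have h1 : Summable fun n => ‖r n • x n‖ := by
    simpa only [norm_smul] using summable_mul_of_sq hr hx
  have h2 : ∑' n, ‖r n • x n‖ₑ ≠ ∞ := by
    simpa only [ofReal_norm] using h1.tsum_ofReal_ne_top
  have h3 : ∀ᵐ u ∂ρ, ∀ n, (r n • x n : Lp ℂ 2 ρ) u = r n * x n u :=
    ae_all_iff.2 fun n => Lp.coeFn_smul (r n) (x n)
  filter_upwards [Lp.hasSum_coeFn_tsum h2, h3] with u hu hu3
  rw [hy.tsum_eq] at hu
  simpa only [hu3] using hu

/-- The restriction of an `L²` function to a set. -/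
noncomputable def indicatorLp {D : Set X} (hD : MeasurableSet D) (f : Lp ℂ 2 ρ) : Lp ℂ 2 ρ :=
  MemLp.toLp (D.indicator (f : X → ℂ)) ((Lp.memLp f).indicator hD)

theorem indicatorLp_coeFn {D : Set X} (hD : MeasurableSet D) (f : Lp ℂ 2 ρ) :
    indicatorLp hD f =ᵐ[ρ] D.indicator (f : X → ℂ) := by
  rw [indicatorLp]
  exact MemLp.coeFn_toLp _

theorem indicatorLp_add {D : Set X} (hD : MeasurableSet D) (f g : Lp ℂ 2 ρ) :
    indicatorLp hD (f + g) = indicatorLp hD f + indicatorLp hD g := by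
  refine Lp.ext ?_
  filter_upwards [Lp.coeFn_add f g, Lp.coeFn_add (indicatorLp hD f) (indicatorLp hD g),
    indicatorLp_coeFn hD f, indicatorLp_coeFn hD g, indicatorLp_coeFn hD (f + g)]
    with x h1 h2 h3 h4 h5
  rw [h5, h2, Pi.add_apply, h3, h4]
  by_cases h : x ∈ D
  · rw [indicator_of_mem h, indicator_of_mem h, indicator_of_mem h, h1, Pi.add_apply]
  · rw [indicator_of_notMem h, indicator_of_notMem h, indicator_of_notMem h, add_zero]

theorem indicatorLp_smul {D : Set X} (hD : MeasurableSet D) (c : ℂ) (f : Lp ℂ 2 ρ) :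
    indicatorLp hD (c • f) = c • indicatorLp hD f := by
  refine Lp.ext ?_
  filter_upwards [Lp.coeFn_smul c f, Lp.coeFn_smul c (indicatorLp hD f),
    indicatorLp_coeFn hD f, indicatorLp_coeFn hD (c • f)] with x h1 h2 h3 h4
  rw [h4, h2, Pi.smul_apply, h3]
  by_cases h : x ∈ D
  · rw [indicator_of_mem h, indicator_of_mem h, h1, Pi.smul_apply]
  · rw [indicator_of_notMem h, indicator_of_notMem h, smul_zero]

theorem norm_indicatorLp_le {D : Set X} (hD : MeasurableSet D) (f : Lp ℂ 2 ρ) :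
    ‖indicatorLp hD f‖ ≤ ‖f‖ := by
  refine Lp.norm_le_norm_of_ae_le ?_
  filter_upwards [indicatorLp_coeFn hD f] with x hx
  rw [hx]
  exact norm_indicator_le_norm_self _ _

/-- The orthogonal projection of `L²` given by the restriction to a set. -/
noncomputable def indicatorProj {D : Set X} (hD : MeasurableSet D) : Lp ℂ 2 ρ →L[ℂ] Lp ℂ 2 ρ :=
  LinearMap.mkContinuous
    { toFun := indicatorLp hD
      map_add' := indicatorLp_add hD
      map_smul' := indicatorLp_smul hD } 1 fun f => by
    rw [one_mul]
    exact norm_indicatorLp_le hD f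

theorem indicatorProj_coeFn {D : Set X} (hD : MeasurableSet D) (f : Lp ℂ 2 ρ) :
    indicatorProj hD f =ᵐ[ρ] D.indicator (f : X → ℂ) :=
  indicatorLp_coeFn hD f

theorem inner_indicatorProj {D : Set X} (hD : MeasurableSet D) (f g : Lp ℂ 2 ρ) :
    inner ℂ f (indicatorProj hD g) = ∫ x in D, g x * starRingEnd ℂ (f x) ∂ρ := by
  rw [L2.inner_def, ← integral_indicator hD]
  refine integral_congr_ae ?_
  filter_upwards [indicatorProj_coeFn hD g] with x hx
  rw [hx, RCLike.inner_apply]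
  by_cases h : x ∈ D <;> simp [h]

theorem inner_indicatorProj_left {D : Set X} (hD : MeasurableSet D) (f g : Lp ℂ 2 ρ) :
    inner ℂ (indicatorProj hD f) g = inner ℂ f (indicatorProj hD g) := by
  rw [inner_indicatorProj, ← inner_conj_symm, inner_indicatorProj, ← integral_conj]
  refine integral_congr_ae (.of_forall fun x => ?_)
  simp [mul_comm]

theorem indicatorProj_idem {D : Set X} (hD : MeasurableSet D) (f : Lp ℂ 2 ρ) :
    indicatorProj hD (indicatorProj hD f) = indicatorProj hD f := by
  refine Lp.ext ?_
  filter_upwards [indicatorProj_coeFn hD f, indicatorProj_coeFn hD (indicatorProj hD f)] with x h h'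
  rw [h']
  by_cases hx : x ∈ D <;> simp [hx, h]

theorem sub_indicatorProj {D D' : Set X} (hD : MeasurableSet D) (hD' : MeasurableSet D')
    (hdisj : Disjoint D D') (hfull : ∀ᵐ x ∂ρ, x ∈ D ∪ D') (f : Lp ℂ 2 ρ) :
    f - indicatorProj hD f = indicatorProj hD' f := by
  refine Lp.ext ?_
  filter_upwards [indicatorProj_coeFn hD f, indicatorProj_coeFn hD' f,
    Lp.coeFn_sub f (indicatorProj hD f), hfull] with x h h' hs hx
  rw [hs, Pi.sub_apply, h, h']
  rcases hx with hx | hx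
  · simp [hx, disjoint_left.1 hdisj hx]
  · simp [hx, disjoint_right.1 hdisj hx]

/-- In a countably generated space, vanishing almost everywhere can be tested by integrals over
countably many sets of finite measure. -/
theorem exists_countable_testing [MeasurableSpace.CountablyGenerated X] [SigmaFinite ρ] :
    ∃ 𝒬 : Set (Set X), 𝒬.Countable ∧ (∀ Q ∈ 𝒬, MeasurableSet Q ∧ ρ Q ≠ ∞) ∧
      ∀ g : X → ℂ, (∀ Q ∈ 𝒬, IntegrableOn g Q ρ ∧ ∫ x in Q, g x ∂ρ = 0) → ∀ᵐ x ∂ρ, g x = 0 := by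
  set 𝒜 := generateSetAlgebra (MeasurableSpace.countableGeneratingSet X)
  have h𝒜 : IsSetAlgebra 𝒜 := isSetAlgebra_generateSetAlgebra
  have hgen : ‹MeasurableSpace X› = MeasurableSpace.generateFrom 𝒜 := by
    rw [generateFrom_generateSetAlgebra_eq, MeasurableSpace.generateFrom_countableGeneratingSet]
  have hmeas : ∀ A ∈ 𝒜, MeasurableSet A := fun A hA => by
    rw [hgen]; exact MeasurableSpace.measurableSet_generateFrom hA
  have hcount : 𝒜.Countable :=
    countable_generateSetAlgebra (MeasurableSpace.countable_countableGeneratingSet)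
  refine ⟨⋃ m : ℕ, (fun A => A ∩ spanningSets ρ m) '' 𝒜,
    countable_iUnion fun m => hcount.image _, ?_, ?_⟩
  · rintro Q hQ
    obtain ⟨m, A, hA, rfl⟩ := mem_iUnion.1 hQ
    exact ⟨(hmeas A hA).inter (measurableSet_spanningSets ρ m),
      ((measure_mono inter_subset_right).trans_lt (measure_spanningSets_lt_top ρ m)).ne⟩
  · intro g hg
    have hm : ∀ m, ∀ᵐ x ∂(ρ.restrict (spanningSets ρ m)), g x = 0 := by
      intro m
      have hint : Integrable g (ρ.restrict (spanningSets ρ m)) := by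
        have := (hg (univ ∩ spanningSets ρ m) (mem_iUnion.2 ⟨m, univ, h𝒜.univ_mem, rfl⟩)).1
        rwa [univ_inter] at this
      have htot : ∫ x, g x ∂(ρ.restrict (spanningSets ρ m)) = 0 := by
        have := (hg (univ ∩ spanningSets ρ m) (mem_iUnion.2 ⟨m, univ, h𝒜.univ_mem, rfl⟩)).2
        rwa [univ_inter] at this
      refine hint.ae_eq_zero_of_forall_setIntegral_eq_zero fun A hA _ => ?_
      -- The π-λ theorem on a spanning set; the vanishing total integral handles complements.
      refine MeasurableSpace.induction_on_inter
        (C := fun A _ => ∫ x in A, g x ∂(ρ.restrict (spanningSets ρ m)) = 0) hgen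
        (fun s hs t ht _ => h𝒜.inter_mem hs ht) (by simp) (fun A hA => ?_) (fun A hA h => ?_)
        (fun s hd hs h => ?_) A hA
      · rw [Measure.restrict_restrict (hmeas A hA)]
        exact (hg _ (mem_iUnion.2 ⟨m, A, hA, rfl⟩)).2
      · have := integral_add_compl hA hint
        rwa [h, htot, zero_add] at this
      · rw [integral_iUnion hs hd hint.integrableOn]
        simp [h]
    have := (ae_restrict_iUnion_iff (μ := ρ) (spanningSets ρ) fun x => g x = 0).2 hm
    rwa [iUnion_spanningSets, Measure.restrict_univ] at this

end L2

/-! ### Pointwise kernels of nuclear operators and of their products -/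

section NuclearKernel

variable {X : Type*} [MeasurableSpace X] {ρ : Measure X}

/-- The superposition of a square summable sequence in `L²`, as a vector of `L²` and pointwise. -/
theorem exists_L2_superposition {r : ℕ → ℂ} {x : ℕ → Lp ℂ 2 ρ}
    (hr : Summable fun n => ‖r n‖ ^ 2) (hx : Summable fun n => ‖x n‖ ^ 2) :
    ∃ y : Lp ℂ 2 ρ, HasSum (fun n => r n • x n) y ∧ ∀ᵐ u ∂ρ, HasSum (fun n => r n * x n u) (y u) := by
  have h1 : Summable fun n => ‖r n • x n‖ := by
    simpa only [norm_smul] using summable_mul_of_sq hr hx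
  exact ⟨_, h1.of_norm.hasSum, ae_hasSum_coeFn hr hx h1.of_norm.hasSum⟩

theorem summable_norm_conj_sq {r : ℕ → ℂ} (hr : Summable fun n => ‖r n‖ ^ 2) :
    Summable fun n => ‖starRingEnd ℂ (r n)‖ ^ 2 := by
  simpa only [RCLike.norm_conj] using hr

/-- The inner products of a superposition. -/
theorem hasSum_inner_superposition {E : Type*} [NormedAddCommGroup E] [InnerProductSpace ℂ E]
    {r : ℕ → ℂ} {a : ℕ → E} {κ : E} (hκ : HasSum (fun n => starRingEnd ℂ (r n) • a n) κ) (ψ : E) :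
    HasSum (fun n => inner ℂ (a n) ψ * r n) (inner ℂ κ ψ) := by
  have h := (hκ.mapL (innerSL ℂ ψ)).map (starRingEnd ℂ) Complex.continuous_conj
  simp only [innerSL_apply_apply, inner_conj_symm] at h
  refine h.congr_fun fun n => ?_
  rw [Function.comp_apply, inner_conj_symm, inner_smul_left, starRingEnd_self_apply, mul_comm]

theorem ae_hasSum_apply {a b : ℕ → Lp ℂ 2 ρ} {T : Lp ℂ 2 ρ →L[ℂ] Lp ℂ 2 ρ}
    (ha : Summable fun n => ‖a n‖ ^ 2)
    (hb : Summable fun n => ‖b n‖ ^ 2) 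
    (hT : ∀ x, HasSum (fun n => inner ℂ (a n) x • b n) (T x))
    (φ : Lp ℂ 2 ρ) :
    ∀ᵐ u ∂ρ, HasSum (fun n => inner ℂ (a n) φ * b n u) (T φ u) := by
  refine ae_hasSum_coeFn ?_ hb (hT φ)
  refine (ha.mul_left (‖φ‖ ^ 2)).of_nonneg_of_le (fun n => by positivity) fun n => ?_
  rw [← mul_pow, mul_comm]
  exact pow_le_pow_left₀ (norm_nonneg _) (norm_inner_le_norm _ _) 2

/-- The kernel of a nuclear integral operator `∑ₙ ⟨aₙ, ·⟩ bₙ` is `∑ₙ bₙ(u) conj aₙ(v)`. -/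
theorem ae_ae_hasSum_kernel [MeasurableSpace.CountablyGenerated X] [SigmaFinite ρ]
    {a b : ℕ → Lp ℂ 2 ρ} {T : Lp ℂ 2 ρ →L[ℂ] Lp ℂ 2 ρ}
    (ha : Summable fun n => ‖a n‖ ^ 2)
    (hb : Summable fun n => ‖b n‖ ^ 2) 
    (hT : ∀ x, HasSum (fun n => inner ℂ (a n) x • b n) (T x))
    {K : X → X → ℂ} (hK : ∀ φ : Lp ℂ 2 ρ, ∀ᵐ u ∂ρ,
      Integrable (fun v => K u v * φ v) ρ ∧ T φ u = ∫ v, K u v * φ v ∂ρ) :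
    ∀ᵐ u ∂ρ, ∀ᵐ v ∂ρ, HasSum (fun n => b n u * starRingEnd ℂ (a n v)) (K u v) := by
  obtain ⟨𝒬, hcount, hQ, htest⟩ := exists_countable_testing (ρ := ρ)
  have : Countable 𝒬 := hcount.to_subtype
  -- The exceptional set of u in `hK` depends on φ; countably many test functions have a common one.
  let φ : 𝒬 → Lp ℂ 2 ρ := fun Q => indicatorConstLp 2 (hQ Q Q.2).1 (hQ Q Q.2).2 (1 : ℂ)
  have hφ : ∀ Q : 𝒬, ∀ᵐ v ∂ρ, φ Q v = (Q : Set X).indicator 1 v := fun Q =>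
    indicatorConstLp_coeFn
  have h1 := ae_all_iff.2 fun Q => hK (φ Q)
  have h2 := ae_all_iff.2 fun Q => ae_hasSum_apply ha hb hT (φ Q)
  filter_upwards [h1, h2, ae_summable_sq hb] with u hu1 hu2 hu3
  obtain ⟨κ, hκ, hκu⟩ := exists_L2_superposition (summable_norm_conj_sq hu3) ha
  -- With κ = ∑ conj(bₙ(u)) aₙ, the number ⟨κ, φ⟩ is the value of T φ at u, so conj κ must be the
  -- section K(u, ·).
  have hTφ := hasSum_inner_superposition hκ
  have hg := htest (fun v => K u v - starRingEnd ℂ (κ v)) fun Q hQ' => ?_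
  · filter_upwards [hg, hκu] with v hv hv'
    have h := hv'.map (starRingEnd ℂ) Complex.continuous_conj
    rw [← sub_eq_zero.1 hv] at h
    refine h.congr_fun fun n => ?_
    rw [Function.comp_apply, map_mul, starRingEnd_self_apply]
  · have hmQ := (hQ Q hQ').1
    have hi : ∀ᵐ v ∂ρ, K u v * φ ⟨Q, hQ'⟩ v = Q.indicator (K u) v := by
      filter_upwards [hφ ⟨Q, hQ'⟩] with v hv
      rw [hv]
      by_cases h : v ∈ Q <;> simp [h]
    have hint1 : IntegrableOn (K u) Q ρ := by
      rw [← integrable_indicator_iff hmQ]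
      exact (hu1 ⟨Q, hQ'⟩).1.congr hi
    have hint2 : IntegrableOn (fun v => starRingEnd ℂ (κ v)) Q ρ := by
      have h := L2.integrable_inner (𝕜 := ℂ) κ (φ ⟨Q, hQ'⟩)
      rw [← integrable_indicator_iff hmQ]
      refine h.congr ?_
      filter_upwards [hφ ⟨Q, hQ'⟩] with v hv
      rw [RCLike.inner_apply, hv]
      by_cases h : v ∈ Q <;> simp [h]
    refine ⟨hint1.sub hint2, ?_⟩
    rw [integral_sub hint1 hint2, sub_eq_zero]
    have e1 : ∫ v in Q, K u v ∂ρ = T (φ ⟨Q, hQ'⟩) u := by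
      rw [(hu1 ⟨Q, hQ'⟩).2, ← integral_indicator hmQ]
      exact (integral_congr_ae hi).symm
    have e2 : ∫ v in Q, starRingEnd ℂ (κ v) ∂ρ = inner ℂ κ (φ ⟨Q, hQ'⟩) := by
      rw [L2.inner_def, ← integral_indicator hmQ]
      refine integral_congr_ae ?_
      filter_upwards [hφ ⟨Q, hQ'⟩] with v hv
      rw [RCLike.inner_apply, hv]
      by_cases h : v ∈ Q <;> simp [h]
    rw [e1, e2]
    exact (hu2 ⟨Q, hQ'⟩).unique (hTφ _)

/-- The same, with the roles of the variables interchanged. -/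
theorem ae_ae_hasSum_swap [SigmaFinite ρ] {a b : ℕ → Lp ℂ 2 ρ} (ha : Summable fun n => ‖a n‖ ^ 2)
    (hb : Summable fun n => ‖b n‖ ^ 2) 
    {K : X → X → ℂ}
    (hKm : AEMeasurable (Function.uncurry K) (ρ.prod ρ))
    (h : ∀ᵐ u ∂ρ, ∀ᵐ v ∂ρ, HasSum (fun n => b n u * starRingEnd ℂ (a n v)) (K u v)) :
    ∀ᵐ v ∂ρ, ∀ᵐ u ∂ρ, HasSum (fun n => b n u * starRingEnd ℂ (a n v)) (K u v) := by
  -- The two quantifiers are exchanged through the product measure, which requires measurability of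
  -- both K and the explicit sum.
  let K₂ : X × X → ℂ := fun p => ∑' n, b n p.1 * starRingEnd ℂ (a n p.2)
  have hgood : ∀ᵐ p ∂(ρ.prod ρ), Summable fun n => b n p.1 * starRingEnd ℂ (a n p.2) := by
    have h1 := (Measure.quasiMeasurePreserving_fst (μ := ρ) (ν := ρ)).ae (ae_summable_sq hb)
    have h2 := (Measure.quasiMeasurePreserving_snd (μ := ρ) (ν := ρ)).ae (ae_summable_sq ha)
    filter_upwards [h1, h2] with p hp1 hp2
    refine Summable.of_norm ?_
    simpa only [norm_mul, RCLike.norm_conj] using summable_mul_of_sq hp1 hp2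
  have hK₂m : AEMeasurable K₂ (ρ.prod ρ) := by
    let f : ℕ → X × X → ℂ := fun N p => ∑ n ∈ Finset.range N, b n p.1 * starRingEnd ℂ (a n p.2)
    have hf : ∀ N, Measurable (f N) := by
      intro N
      refine Finset.measurable_fun_sum _ fun n _ => ?_
      have m1 : Measurable fun p : X × X => b n p.1 :=
        (Lp.stronglyMeasurable (b n)).measurable.comp measurable_fst
      have m2 : Measurable fun p : X × X => a n p.2 :=
        (Lp.stronglyMeasurable (a n)).measurable.comp measurable_snd
      exact m1.mul (Complex.continuous_conj.measurable.comp m2)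
    have hlim : ∀ᵐ p ∂(ρ.prod ρ), Tendsto (fun N => f N p) atTop (𝓝 (K₂ p)) :=
      hgood.mono fun p hp => hp.hasSum.tendsto_sum_nat
    exact aemeasurable_of_tendsto_metrizable_ae atTop (fun N => (hf N).aemeasurable) hlim
  have hprod : ∀ᵐ p ∂(ρ.prod ρ), Function.uncurry K p = K₂ p := by
    have h1 := hKm.ae_eq_mk
    have h2 := hK₂m.ae_eq_mk
    have h3 : ∀ᵐ p ∂(ρ.prod ρ), hKm.mk _ p = hK₂m.mk _ p := by
      rw [Measure.ae_prod_iff_ae_ae (measurableSet_eq_fun hKm.measurable_mk hK₂m.measurable_mk)]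
      filter_upwards [h, Measure.ae_ae_of_ae_prod h1, Measure.ae_ae_of_ae_prod h2] with u g1 g2 g3
      filter_upwards [g1, g2, g3] with v g1 g2 g3
      rw [← g2, ← g3]
      exact g1.tsum_eq.symm
    filter_upwards [h1, h2, h3] with p g1 g2 g3
    rw [g1, g2, g3]
  have hall : ∀ᵐ p ∂(ρ.prod ρ),
      HasSum (fun n => b n p.1 * starRingEnd ℂ (a n p.2)) (K p.1 p.2) := by
    filter_upwards [hprod, hgood] with p g1 g2
    have : K p.1 p.2 = K₂ p := g1
    rw [this]
    exact g2.hasSum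
  have := (Measure.measurePreserving_swap (μ := ρ) (ν := ρ)).quasiMeasurePreserving.ae hall
  exact Measure.ae_ae_of_ae_prod this

/-- The kernel of `T χ_D T` for a nuclear integral operator `T`, including its values on the
diagonal. -/
theorem exists_hasSum_compKernel [MeasurableSpace.CountablyGenerated X] [SigmaFinite ρ]
    {a b : ℕ → Lp ℂ 2 ρ} {T : Lp ℂ 2 ρ →L[ℂ] Lp ℂ 2 ρ}
    (ha : Summable fun n => ‖a n‖ ^ 2)
    (hb : Summable fun n => ‖b n‖ ^ 2) 
    (hT : ∀ x, HasSum (fun n => inner ℂ (a n) x • b n) (T x))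
    {K : X → X → ℂ} (hKm : AEMeasurable (Function.uncurry K) (ρ.prod ρ))
    (hK : ∀ φ : Lp ℂ 2 ρ, ∀ᵐ u ∂ρ,
      Integrable (fun v => K u v * φ v) ρ ∧ T φ u = ∫ v, K u v * φ v ∂ρ)
    {D : Set X} (hD : MeasurableSet D) :
    ∃ S : Set X, (∀ᵐ u ∂ρ, u ∈ S) ∧ ∀ u ∈ S, ∀ w ∈ S,
      HasSum (fun n => T (indicatorProj hD (b n)) u * starRingEnd ℂ (a n w))
        (∫ v in D, K u v * K v w ∂ρ) := by
  have h1 := ae_ae_hasSum_kernel ha hb hT hK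
  have h2 := ae_ae_hasSum_swap ha hb hKm h1
  have h3 := ae_all_iff.2 fun n => ae_hasSum_apply ha hb hT (indicatorProj hD (b n))
  refine ⟨_, (h1.and (h2.and (h3.and ((ae_summable_sq ha).and (ae_summable_sq hb))))), ?_⟩
  rintro u ⟨hu1, -, hu3, -, hub⟩ w ⟨-, hw2, -, hwa, -⟩
  -- Almost everywhere in v, K(u, v) = conj κ(v) and K(v, w) = l(v). The integral over D is thus ⟨κ,
  -- χ_D l⟩, an honest inner product for each pair u, w; expanding l gives the series.
  obtain ⟨κ, hκ, hκu⟩ := exists_L2_superposition (summable_norm_conj_sq hub) ha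
  obtain ⟨l, hl, hlu⟩ := exists_L2_superposition (summable_norm_conj_sq hwa) hb
  have hTφ := hasSum_inner_superposition hκ
  have e1 : ∀ᵐ v ∂ρ, K u v * K v w = l v * starRingEnd ℂ (κ v) := by
    filter_upwards [hu1, hw2, hκu, hlu] with v g1 g2 g3 g4
    have g3' := g3.map (starRingEnd ℂ) Complex.continuous_conj
    have e3 : K u v = starRingEnd ℂ (κ v) := by
      refine g1.unique (g3'.congr_fun fun n => ?_)
      rw [Function.comp_apply, map_mul, starRingEnd_self_apply]
    have e4 : K v w = l v := g2.unique (g4.congr_fun fun n => mul_comm _ _)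
    rw [e3, e4, mul_comm]
  rw [integral_congr_ae (ae_restrict_of_ae e1), ← inner_indicatorProj hD]
  have h5 := (hl.mapL (indicatorProj hD)).mapL (innerSL ℂ κ)
  simp only [innerSL_apply_apply, map_smul, smul_eq_mul] at h5
  refine h5.congr_fun fun n => ?_
  rw [(hu3 n).unique (hTφ _), mul_comm]

end NuclearKernel

/-! ### Off-diagonal integral operators -/

/-- The Fredholm determinant of a trace class integral operator whose kernel is off-diagonal with
respect to a decomposition of the space into two parts. -/
theorem hasFredholmDet_of_off_diagonal {ρ : Measure ℂ} [SigmaFinite ρ] {τ : ℂ → ℂ} {K : ℂ → ℂ → ℂ}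
    {D₁ D₂ : Set ℂ} (hD₁ : MeasurableSet D₁) (hD₂ : MeasurableSet D₂) (hdisj : Disjoint D₁ D₂)
    (hfull : ∀ᵐ x ∂ρ, x ∈ D₁ ∪ D₂)
    (hKm : AEMeasurable (Function.uncurry K) (ρ.prod ρ)) (hτ : AEMeasurable τ ρ)
    (h11 : ∀ u ∈ D₁, ∀ v ∈ D₁, K u v = 0) (h22 : ∀ u ∈ D₂, ∀ v ∈ D₂, K u v = 0)
    {T : Lp ℂ 2 ρ →L[ℂ] Lp ℂ 2 ρ} (hTK : IsIntegralOperator ρ τ K T) (hT : IsTraceClass T) :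
    HasFredholmDet T
      (fredholmSeries (ρ.restrict D₁) τ (compKernel (ρ.restrict D₂) τ K K)) := by
  obtain ⟨a, b, ha, hb, hTab⟩ := hT.exists_sq_summable
  have hs : Summable fun n => ‖a n‖ * ‖b n‖ := summable_mul_of_sq ha hb
  -- The weight τ goes into the second variable, so that T is an ordinary integral operator with
  -- respect to ρ.
  let k : ℂ → ℂ → ℂ := fun u v => K u v * τ v
  have hkm : AEMeasurable (Function.uncurry k) (ρ.prod ρ) :=
    hKm.mul (hτ.comp_quasiMeasurePreserving Measure.quasiMeasurePreserving_snd)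
  have hk : ∀ φ : Lp ℂ 2 ρ, ∀ᵐ u ∂ρ,
      Integrable (fun v => k u v * φ v) ρ ∧ T φ u = ∫ v, k u v * φ v ∂ρ := by
    intro φ
    have e : ∀ u v, K u v * φ v * τ v = k u v * φ v := fun u v => by simp only [k]; ring
    simpa only [e] using hTK φ
  have hzero : ∀ {D D' : Set ℂ} (hD : MeasurableSet D), (∀ u ∈ D', ∀ v ∈ D, K u v = 0) →
      ∀ φ : Lp ℂ 2 ρ, ∀ᵐ u ∂ρ, u ∈ D' → T (indicatorProj hD φ) u = 0 := by
    intro D D' hD h φ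
    filter_upwards [hk (indicatorProj hD φ)] with u hu hu'
    rw [hu.2]
    refine integral_eq_zero_of_ae ?_
    filter_upwards [indicatorProj_coeFn hD φ] with v hv
    rw [hv]
    by_cases hvD : v ∈ D
    · simp [k, h u hu' v hvD]
    · simp [hvD]
  have hsub := sub_indicatorProj hD₁ hD₂ hdisj hfull
  have hfred : fredholmSum a b =
      fredholmSum a fun n => indicatorProj hD₁ (T (indicatorProj hD₂ (b n))) := by
    rw [fredholmSum_off_diagonal (P := indicatorProj hD₁) (T := T)
      (inner_indicatorProj_left hD₁) (indicatorProj_idem hD₁) ?_ ?_ hs hTab]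
    · simp only [hsub]
    · intro x
      refine Lp.ext ?_
      filter_upwards [indicatorProj_coeFn hD₁ (T (indicatorProj hD₁ x)), hzero hD₁ h11 x,
        Lp.coeFn_zero ℂ 2 ρ] with u hu hu' h0
      rw [hu, h0]
      by_cases h : u ∈ D₁
      · rw [indicator_of_mem h, hu' h, Pi.zero_apply]
      · rw [indicator_of_notMem h, Pi.zero_apply]
    · intro x
      rw [hsub]
      refine Lp.ext ?_
      filter_upwards [indicatorProj_coeFn hD₁ (T (indicatorProj hD₂ x)), hzero hD₂ h22 x, hfull]
        with u hu hu' hf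
      rw [hu]
      by_cases h : u ∈ D₁
      · rw [indicator_of_mem h]
      · rw [indicator_of_notMem h, hu' (hf.resolve_left h)]
  have hdet := hasFredholmDet_fredholmSum hs hTab
  rw [hfred] at hdet
  convert hdet using 1
  obtain ⟨S, hS, hSsum⟩ := exists_hasSum_compKernel ha hb hTab hkm hk hD₂
  let β : ℕ → Lp ℂ 2 ρ := fun n => T (indicatorProj hD₂ (b n))
  have hβ : ∀ n, ‖β n‖ ≤ ‖T‖ * ‖b n‖ := fun n =>
    (T.le_opNorm _).trans (mul_le_mul_of_nonneg_left (norm_indicatorLp_le hD₂ _) (norm_nonneg _))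
  rw [fredholmSeries, fredholmSum]
  refine tsum_congr fun n => ?_
  rw [fredholmTerm]
  congr 1
  have hker : ∀ x : Fin n → ℂ, fredholmIntegrand τ (compKernel (ρ.restrict D₂) τ K K) n x =
      (Matrix.of fun i j => (fun u w => ∫ v in D₂, k u v * k v w ∂ρ) (x i) (x j)).det := by
    intro x
    -- The factor τ(xⱼ) is multiplied into column j.
    rw [fredholmIntegrand, mul_comm, ← Matrix.det_mul_row]
    congr 1
    ext i j
    simp only [Matrix.of_apply, compKernel, k]
    rw [mul_comm, ← integral_mul_const]
    refine integral_congr_ae (.of_forall fun v => ?_)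
    dsimp only
    ring
  simp only [hker]
  have hint : ∀ n m, Integrable (fun x => β n x * starRingEnd ℂ (a m x)) ρ := fun n m => by
    have := L2.integrable_inner (𝕜 := ℂ) (a m) (β n)
    simpa only [RCLike.inner_apply] using this
  rw [integral_det_kernel (μ := ρ.restrict D₁) (fun n x => starRingEnd ℂ (a n x))
    (fun n x => β n x) _ (fun n => ‖β n‖) (fun n => ‖a n‖) ?_ (fun n m => (hint n m).restrict) ?_ S
    (ae_restrict_of_ae hS) hSsum]
  · refine tsum_congr fun ν => ?_
    simp only [inner_indicatorProj]
    rfl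
  · refine (hs.mul_left ‖T‖).of_nonneg_of_le (fun n => by positivity) fun n => ?_
    calc ‖β n‖ * ‖a n‖ ≤ ‖T‖ * ‖b n‖ * ‖a n‖ := mul_le_mul_of_nonneg_right (hβ n) (norm_nonneg _)
      _ = _ := by ring
  · intro n m
    refine (setIntegral_le_integral (hint n m).norm (.of_forall fun _ => norm_nonneg _)).trans ?_
    simpa only [norm_mul, RCLike.norm_conj] using L2_integral_norm_mul_le (β n) (a m)

/-! ### The structure of the operators of block data -/

namespace BlockData

variable {m : ℕ}

/-- The row of `F` and `G` that is attached to `Ω_{1,i}` in `F` and to `Ω_{2,i}` in `G`. -/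
def rowOdd (i : Fin m) : Fin (m + 1) := ⟨2 * ((i : ℕ) / 2), by omega⟩

/-- The row of `F` and `G` that is attached to `Ω_{2,i}` in `F` and to `Ω_{1,i}` in `G`. -/
def rowEven (i : Fin m) : Fin (m + 1) :=
  ⟨if (i : ℕ) = 0 then m else 2 * (((i : ℕ) - 1) / 2) + 1, by split_ifs <;> omega⟩

/-- With indices from 0, `rowOdd` is even and `rowEven` odd, except that `rowEven` of the first
index is m. That value can be even, but `rowOdd` stays below m. -/
theorem rowOdd_ne_rowEven (i j : Fin m) : rowOdd i ≠ rowEven j := by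
  intro h
  have := congrArg Fin.val h
  simp only [rowOdd, rowEven] at this
  split_ifs at this <;> omega

theorem P_mul_L_inl (k : Fin (m + 1)) (i : Fin m) :
    (P m * L m) k (Sum.inl i) = if k = rowOdd i then 1 else 0 := by
  have h1 : (P m * L m) k (Sum.inl i) =
      ∑ j : Fin m, (if (k : ℕ) = j then Lam₁ m j i else 0) := by
    rw [Matrix.mul_apply, Fintype.sum_sum_type, Finset.sum_eq_zero (f := fun j : Fin m =>
      P m k (Sum.inr j) * L m (Sum.inr j) (Sum.inl i)) (by simp [L]), add_zero]
    refine Finset.sum_congr rfl fun j _ => ?_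
    by_cases h : (k : ℕ) = j <;> simp [P, L, h]
  rw [h1]
  by_cases hk : (k : ℕ) < m
  · rw [Finset.sum_eq_single ⟨k, hk⟩ (fun j _ hj => if_neg fun h => hj (Fin.ext h.symm))
      (fun h => absurd (Finset.mem_univ _) h), if_pos rfl]
    simp only [Lam₁, Matrix.of_apply, Nat.odd_iff, Fin.ext_iff, rowOdd]
    refine if_congr ?_ rfl rfl
    omega
  · rw [Finset.sum_eq_zero fun j _ => if_neg (by omega), if_neg]
    intro h
    have := congrArg Fin.val h
    simp only [rowOdd] at this
    omega

/-- Subtracting `E₁₁` empties the first column of `Lam₂`; the entry reappears in row m, the only row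
of the lower blocks that `P` keeps. -/
theorem P_mul_L_inr (k : Fin (m + 1)) (i : Fin m) :
    (P m * L m) k (Sum.inr i) = if k = rowEven i then 1 else 0 := by
  have h1 : (P m * L m) k (Sum.inr i) =
      (∑ j : Fin m, (if (k : ℕ) = j then (Lam₂ m - E₁₁ m) j i else 0)) +
      ∑ j : Fin m, (if (k : ℕ) = m + j then E₁₁ m j i else 0) := by
    rw [Matrix.mul_apply, Fintype.sum_sum_type]
    congr 1 <;> refine Finset.sum_congr rfl fun j _ => ?_
    · by_cases h : (k : ℕ) = j <;> simp [P, L, h]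
    · by_cases h : (k : ℕ) = m + j <;> simp [P, L, h]
  rw [h1]
  by_cases hk : (k : ℕ) < m
  · rw [Finset.sum_eq_single ⟨k, hk⟩ (fun j _ hj => if_neg fun h => hj (Fin.ext h.symm))
      (fun h => absurd (Finset.mem_univ _) h), if_pos rfl,
      Finset.sum_eq_zero (f := fun j : Fin m => if (k : ℕ) = m + j then E₁₁ m j i else 0)
        fun j _ => if_neg (by omega), add_zero]
    simp only [Lam₂, E₁₁, Matrix.sub_apply, Matrix.of_apply, Nat.even_iff, Fin.ext_iff, rowEven]
    split_ifs <;> first | omega | simp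
  · have hi : 0 < m := i.pos
    rw [Finset.sum_eq_zero fun j _ => if_neg (by omega), zero_add,
      Finset.sum_eq_single ⟨0, hi⟩ (fun j _ hj => if_neg fun h => hj (Fin.ext (by simp; omega)))
      (fun h => absurd (Finset.mem_univ _) h), if_pos (by simp; omega)]
    simp only [E₁₁, Matrix.of_apply, Fin.ext_iff, rowEven, true_and]
    split_ifs <;> first | omega | simp

variable (D : BlockData m)

/-- The diagonal entries of `Δ`. -/
noncomputable def weight (k : Fin (m + 1)) (z : ℂ) : ℂ :=
  Fin.snoc (α := fun _ => ℂ) (fun j : Fin m => D.w j z) 1 k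

theorem weight_of_lt {k : Fin (m + 1)} (h : (k : ℕ) < m) (z : ℂ) :
    D.weight k z = D.w ⟨k, h⟩ z := by
  simp only [weight, Fin.snoc, h, dif_pos]
  rfl

theorem weight_of_eq {k : Fin (m + 1)} (h : (k : ℕ) = m) (z : ℂ) : D.weight k z = 1 := by
  simp [weight, Fin.snoc, h]

theorem weight_ne_zero (hw0 : ∀ j, ∀ z ∈ D.Omega, D.w j z ≠ 0) (k : Fin (m + 1)) {z : ℂ}
    (hz : z ∈ D.Omega) : D.weight k z ≠ 0 := by
  by_cases h : (k : ℕ) < m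
  · rw [D.weight_of_lt h]
    exact hw0 _ z hz
  · rw [D.weight_of_eq (by omega)]
    exact one_ne_zero

/-- This is what ties Δ to the kernels: the factors M and M⁻¹ come from the ratio of the weights in
the two rows attached to i. -/
theorem M_eq (i : Fin m) (z : ℂ) : D.M i z = D.weight (rowOdd i) z / D.weight (rowEven i) z := by
  have hO : ((rowOdd i : Fin (m + 1)) : ℕ) < m := by simp only [rowOdd]; omega
  rw [D.weight_of_lt hO, M]
  by_cases h0 : (i : ℕ) = 0
  · rw [if_pos h0, D.weight_of_eq (by simp [rowEven, h0]), div_one]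
    congr 2
    exact Fin.ext (by simp [rowOdd, h0])
  · have hE : ((rowEven i : Fin (m + 1)) : ℕ) < m := by simp only [rowEven, h0, if_false]; omega
    rw [if_neg h0, D.weight_of_lt hE]
    split_ifs with he
    · rw [Nat.even_iff] at he
      congr 3
      · simp only [rowOdd]; omega
      · simp only [rowEven, h0, if_false, Fin.ext_iff]; omega
    · rw [Nat.even_iff] at he
      congr 3
      · simp only [rowOdd, Fin.ext_iff]; omega
      · simp only [rowEven, h0, if_false]; omega

theorem notMem_of_ne {D : BlockData m}
    (hdisj : Pairwise (Function.onFun Disjoint (Sum.elim D.Ω₁ D.Ω₂))) {s t : Fin m ⊕ Fin m}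
    (hst : s ≠ t) {z : ℂ} (hz : z ∈ Sum.elim D.Ω₁ D.Ω₂ s) : z ∉ Sum.elim D.Ω₁ D.Ω₂ t :=
  disjoint_left.1 (hdisj hst) hz

section Disjoint

variable {D}

theorem mulVec_indicator₁ (hdisj : Pairwise (Function.onFun Disjoint (Sum.elim D.Ω₁ D.Ω₂)))
    (x : Fin m → ℂ) {i : Fin m} {z : ℂ} (hz : z ∈ D.Ω₁ i) :
    ((P m * L m) *ᵥ Sum.elim (fun j => x j * (D.Ω₁ j).indicator 1 z)
      (fun j => x j * (D.Ω₂ j).indicator 1 z) = Pi.single (rowOdd i) (x i)) ∧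
    ((P m * L m) *ᵥ Sum.elim (fun j => x j * (D.Ω₂ j).indicator 1 z)
      (fun j => x j * (D.Ω₁ j).indicator 1 z) = Pi.single (rowEven i) (x i)) := by
  have h1 : (fun j => x j * (D.Ω₁ j).indicator 1 z) = Pi.single i (x i) := by
    ext j
    by_cases hj : j = i
    · subst hj; simp [hz]
    · have : z ∉ D.Ω₁ j := notMem_of_ne hdisj (s := Sum.inl i) (t := Sum.inl j)
        (fun h => hj (Sum.inl_injective h).symm) hz
      simp [this, hj]
  have h2 : (fun j => x j * (D.Ω₂ j).indicator 1 z) = 0 := by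
    ext j
    have : z ∉ D.Ω₂ j := notMem_of_ne hdisj (s := Sum.inl i) (t := Sum.inr j) (by simp) hz
    simp [this]
  rw [h1, h2]
  constructor <;> ext k
  · simp [Matrix.mulVec, dotProduct, Pi.single_apply, P_mul_L_inl]
  · simp [Matrix.mulVec, dotProduct, Pi.single_apply, P_mul_L_inr]

theorem mulVec_indicator₂ (hdisj : Pairwise (Function.onFun Disjoint (Sum.elim D.Ω₁ D.Ω₂)))
    (x : Fin m → ℂ) {i : Fin m} {z : ℂ} (hz : z ∈ D.Ω₂ i) :
    ((P m * L m) *ᵥ Sum.elim (fun j => x j * (D.Ω₁ j).indicator 1 z)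
      (fun j => x j * (D.Ω₂ j).indicator 1 z) = Pi.single (rowEven i) (x i)) ∧
    ((P m * L m) *ᵥ Sum.elim (fun j => x j * (D.Ω₂ j).indicator 1 z)
      (fun j => x j * (D.Ω₁ j).indicator 1 z) = Pi.single (rowOdd i) (x i)) := by
  have h1 : (fun j => x j * (D.Ω₂ j).indicator 1 z) = Pi.single i (x i) := by
    ext j
    by_cases hj : j = i
    · subst hj; simp [hz]
    · have : z ∉ D.Ω₂ j := notMem_of_ne hdisj (s := Sum.inr i) (t := Sum.inr j)
        (fun h => hj (Sum.inr_injective h).symm) hz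
      simp [this, hj]
  have h2 : (fun j => x j * (D.Ω₁ j).indicator 1 z) = 0 := by
    ext j
    have : z ∉ D.Ω₁ j := notMem_of_ne hdisj (s := Sum.inr i) (t := Sum.inl j) (by simp) hz
    simp [this]
  rw [h1, h2]
  constructor <;> ext k
  · simp [Matrix.mulVec, dotProduct, Pi.single_apply, P_mul_L_inr]
  · simp [Matrix.mulVec, dotProduct, Pi.single_apply, P_mul_L_inl]

end Disjoint

theorem f_apply (z : ℂ) (k : Fin (m + 1)) : D.f z k = D.c z * (D.weight k z * D.F z k) := by
  simp [f, Delta, Matrix.mulVec_diagonal, weight]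

theorem g_apply (hw0 : ∀ j, ∀ z ∈ D.Omega, D.w j z ≠ 0) {z : ℂ} (hz : z ∈ D.Omega)
    (k : Fin (m + 1)) : D.g z k = (D.c z)⁻¹ * ((D.weight k z)⁻¹ * D.G z k) := by
  have hinv : (D.Delta z)⁻¹ = Matrix.diagonal fun k => (D.weight k z)⁻¹ := by
    refine Matrix.inv_eq_right_inv ?_
    rw [Delta, Matrix.diagonal_mul_diagonal, ← Matrix.diagonal_one]
    congr 1
    ext k
    exact mul_inv_cancel₀ (D.weight_ne_zero hw0 k hz)
  simp [g, hinv, Matrix.mulVec_diagonal]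

/-- Division by zero gives 0, which agrees with the convention on the diagonal. -/
theorem H_eq (u v : ℂ) : D.H u v = (D.f u ⬝ᵥ D.g v) / (u - v) := by
  rw [H]
  split_ifs with h
  · simp [h]
  · rfl

theorem mem_Omega_of_mem₁ {i : Fin m} {z : ℂ} (hz : z ∈ D.Ω₁ i) : z ∈ D.Omega :=
  Or.inl (mem_iUnion.2 ⟨i, hz⟩)

theorem mem_Omega_of_mem₂ {i : Fin m} {z : ℂ} (hz : z ∈ D.Ω₂ i) : z ∈ D.Omega :=
  Or.inr (mem_iUnion.2 ⟨i, hz⟩)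

section Values

variable {D} {i j : Fin m} {u v z : ℂ}

theorem f_of_mem₁ (hdisj : Pairwise (Function.onFun Disjoint (Sum.elim D.Ω₁ D.Ω₂)))
    (hz : z ∈ D.Ω₁ i) :
    D.f z = Pi.single (rowOdd i) (D.c z * (D.weight (rowOdd i) z * D.A i z)) := by
  ext k
  rw [f_apply, F, (mulVec_indicator₁ hdisj (fun j => D.A j z) hz).1]
  by_cases h : k = rowOdd i
  · subst h; simp
  · simp [h]

theorem f_of_mem₂ (hdisj : Pairwise (Function.onFun Disjoint (Sum.elim D.Ω₁ D.Ω₂)))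
    (hz : z ∈ D.Ω₂ i) :
    D.f z = Pi.single (rowEven i) (D.c z * (D.weight (rowEven i) z * D.A i z)) := by
  ext k
  rw [f_apply, F, (mulVec_indicator₂ hdisj (fun j => D.A j z) hz).1]
  by_cases h : k = rowEven i
  · subst h; simp
  · simp [h]

theorem g_of_mem₁ (hdisj : Pairwise (Function.onFun Disjoint (Sum.elim D.Ω₁ D.Ω₂)))
    (hw0 : ∀ j, ∀ z ∈ D.Omega, D.w j z ≠ 0) (hz : z ∈ D.Ω₁ i) :
    D.g z = Pi.single (rowEven i) ((D.c z)⁻¹ * ((D.weight (rowEven i) z)⁻¹ * D.B i z)) := by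
  ext k
  rw [D.g_apply hw0 (D.mem_Omega_of_mem₁ hz), G, (mulVec_indicator₁ hdisj (fun j => D.B j z) hz).2]
  by_cases h : k = rowEven i
  · subst h; simp
  · simp [h]

theorem g_of_mem₂ (hdisj : Pairwise (Function.onFun Disjoint (Sum.elim D.Ω₁ D.Ω₂)))
    (hw0 : ∀ j, ∀ z ∈ D.Omega, D.w j z ≠ 0) (hz : z ∈ D.Ω₂ i) :
    D.g z = Pi.single (rowOdd i) ((D.c z)⁻¹ * ((D.weight (rowOdd i) z)⁻¹ * D.B i z)) := by
  ext k
  rw [D.g_apply hw0 (D.mem_Omega_of_mem₂ hz), G, (mulVec_indicator₂ hdisj (fun j => D.B j z) hz).2]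
  by_cases h : k = rowOdd i
  · subst h; simp
  · simp [h]

theorem f_mul_g_eq_zero (hdisj : Pairwise (Function.onFun Disjoint (Sum.elim D.Ω₁ D.Ω₂)))
    (hw0 : ∀ j, ∀ z ∈ D.Omega, D.w j z ≠ 0) (hz : z ∈ D.Omega) (k : Fin (m + 1)) :
    D.f z k * D.g z k = 0 := by
  rcases hz with hz | hz <;> obtain ⟨i, hi⟩ := mem_iUnion.1 hz
  · rw [f_of_mem₁ hdisj hi, g_of_mem₁ hdisj hw0 hi]
    by_cases h : k = rowOdd i
    · rw [Pi.single_eq_of_ne (i := rowEven i) (h ▸ rowOdd_ne_rowEven i i), mul_zero]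
    · rw [Pi.single_eq_of_ne h, zero_mul]
  · rw [f_of_mem₂ hdisj hi, g_of_mem₂ hdisj hw0 hi]
    by_cases h : k = rowOdd i
    · rw [Pi.single_eq_of_ne (i := rowEven i) (h ▸ rowOdd_ne_rowEven i i), zero_mul]
    · rw [Pi.single_eq_of_ne h, mul_zero]

theorem H_eq_zero₁ (hdisj : Pairwise (Function.onFun Disjoint (Sum.elim D.Ω₁ D.Ω₂)))
    (hw0 : ∀ j, ∀ z ∈ D.Omega, D.w j z ≠ 0) (hu : u ∈ D.Omega₁) (hv : v ∈ D.Omega₁) :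
    D.H u v = 0 := by
  obtain ⟨i, hi⟩ := mem_iUnion.1 hu
  obtain ⟨j, hj⟩ := mem_iUnion.1 hv
  rw [H_eq, f_of_mem₁ hdisj hi, g_of_mem₁ hdisj hw0 hj, single_dotProduct,
    Pi.single_eq_of_ne (rowOdd_ne_rowEven i j), mul_zero, zero_div]

theorem H_eq_zero₂ (hdisj : Pairwise (Function.onFun Disjoint (Sum.elim D.Ω₁ D.Ω₂)))
    (hw0 : ∀ j, ∀ z ∈ D.Omega, D.w j z ≠ 0) (hu : u ∈ D.Omega₂) (hv : v ∈ D.Omega₂) :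
    D.H u v = 0 := by
  obtain ⟨i, hi⟩ := mem_iUnion.1 hu
  obtain ⟨j, hj⟩ := mem_iUnion.1 hv
  rw [H_eq, f_of_mem₂ hdisj hi, g_of_mem₂ hdisj hw0 hj, single_dotProduct,
    Pi.single_eq_of_ne (rowOdd_ne_rowEven j i).symm, mul_zero, zero_div]

/-- Counted from 1, both conditions say that i and j lie in the same block of {1, 2}, {3, 4}, …;
these are the blocks of `Lam₁`. -/
theorem kron_add_kron₁ (i j : Fin m) :
    kron ((i : ℤ) + 1) ((j : ℤ) + 1) + kron ((i : ℤ) + 1) ((j : ℤ) + 1 + (-1) ^ ((i : ℕ) + 1)) =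
      if rowOdd i = rowOdd j then 1 else 0 := by
  simp only [kron, rowOdd, Fin.ext_iff]
  rcases Nat.even_or_odd ((i : ℕ) + 1) with h | h
  · rw [h.neg_one_pow]
    rw [Nat.even_iff] at h
    split_ifs <;> first | omega | simp
  · rw [h.neg_one_pow]
    rw [Nat.odd_iff] at h
    split_ifs <;> first | omega | simp

/-- Here the blocks are {1}, {2, 3}, {4, 5}, …, those of `Lam₂`. -/
theorem kron_add_kron₂ (i j : Fin m) :
    kron ((i : ℤ) + 1) ((j : ℤ) + 1) + kron ((i : ℤ) + 1) ((j : ℤ) + 1 - (-1) ^ ((i : ℕ) + 1)) =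
      if rowEven i = rowEven j then 1 else 0 := by
  simp only [kron, rowEven, Fin.ext_iff]
  rcases Nat.even_or_odd ((i : ℕ) + 1) with h | h
  · rw [h.neg_one_pow]
    rw [Nat.even_iff] at h
    split_ifs <;> first | omega | simp
  · rw [h.neg_one_pow]
    rw [Nat.odd_iff] at h
    split_ifs <;> first | omega | simp

theorem K₁_of_mem (hdisj : Pairwise (Function.onFun Disjoint (Sum.elim D.Ω₁ D.Ω₂)))
    (hu : u ∈ D.Ω₁ i) (hv : v ∈ D.Ω₂ j) :
    D.K₁ u v = (if rowOdd i = rowOdd j then 1 else 0) * (D.M i u * D.A i u * D.B j v / (u - v)) := by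
  have h1 : ∀ i', i' ≠ i → u ∉ D.Ω₁ i' := fun i' h => notMem_of_ne hdisj (s := Sum.inl i)
    (t := Sum.inl i') (fun h' => h (Sum.inl_injective h').symm) hu
  have h2 : ∀ j', j' ≠ j → v ∉ D.Ω₂ j' := fun j' h => notMem_of_ne hdisj (s := Sum.inr j)
    (t := Sum.inr j') (fun h' => h (Sum.inr_injective h').symm) hv
  rw [K₁, Finset.sum_eq_single i, Finset.sum_eq_single j, if_pos ⟨hu, hv⟩, kron_add_kron₁]
  · exact fun j' _ h => if_neg fun h' => h2 j' h h'.2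
  · exact fun h => absurd (Finset.mem_univ _) h
  · exact fun i' _ h => Finset.sum_eq_zero fun j' _ => if_neg fun h' => h1 i' h h'.1
  · exact fun h => absurd (Finset.mem_univ _) h

theorem K₂_of_mem (hdisj : Pairwise (Function.onFun Disjoint (Sum.elim D.Ω₁ D.Ω₂)))
    (hu : u ∈ D.Ω₂ i) (hv : v ∈ D.Ω₁ j) :
    D.K₂ u v = (if rowEven i = rowEven j then 1 else 0) *
      ((D.M i u)⁻¹ * D.A i u * D.B j v / (u - v)) := by
  have h1 : ∀ i', i' ≠ i → u ∉ D.Ω₂ i' := fun i' h => notMem_of_ne hdisj (s := Sum.inr i)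
    (t := Sum.inr i') (fun h' => h (Sum.inr_injective h').symm) hu
  have h2 : ∀ j', j' ≠ j → v ∉ D.Ω₁ j' := fun j' h => notMem_of_ne hdisj (s := Sum.inl j)
    (t := Sum.inl j') (fun h' => h (Sum.inl_injective h').symm) hv
  rw [K₂, Finset.sum_eq_single i, Finset.sum_eq_single j, if_pos ⟨hu, hv⟩, kron_add_kron₂]
  · exact fun j' _ h => if_neg fun h' => h2 j' h h'.2
  · exact fun h => absurd (Finset.mem_univ _) h
  · exact fun i' _ h => Finset.sum_eq_zero fun j' _ => if_neg fun h' => h1 i' h h'.1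
  · exact fun h => absurd (Finset.mem_univ _) h

/-- The two kernels are conjugate to the off-diagonal blocks of `H` by non-vanishing functions. -/
theorem exists_conjugation (hdisj : Pairwise (Function.onFun Disjoint (Sum.elim D.Ω₁ D.Ω₂)))
    (hw0 : ∀ j, ∀ z ∈ D.Omega, D.w j z ≠ 0) (hc0 : ∀ z ∈ D.Omega, D.c z ≠ 0) :
    ∃ p q : ℂ → ℂ, (∀ u ∈ D.Omega₁, p u ≠ 0) ∧ (∀ v ∈ D.Omega₂, q v ≠ 0) ∧
      (∀ u ∈ D.Omega₁, ∀ v ∈ D.Omega₂, D.H u v = p u * D.K₁ u v / q v) ∧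
      (∀ u ∈ D.Omega₂, ∀ v ∈ D.Omega₁, D.H u v = q u * D.K₂ u v / p v) := by
  -- H₁₂ carries the weight of `rowOdd i` at u, equal to M_i(u) times the weight of `rowEven i`.
  -- Removing M_i leaves p = c · weight(`rowEven i`); the inverse weight at v gives q = c ·
  -- weight(`rowOdd j`).
  have hp : ∀ u, ∃ y, ∀ i, u ∈ D.Ω₁ i → y = D.c u * D.weight (rowEven i) u := by
    intro u
    by_cases h : ∃ i, u ∈ D.Ω₁ i
    · obtain ⟨i, hi⟩ := h
      refine ⟨D.c u * D.weight (rowEven i) u, fun j hj => ?_⟩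
      have : i = j := by
        by_contra hne
        exact notMem_of_ne hdisj (s := Sum.inl i) (t := Sum.inl j)
          (fun h' => hne (Sum.inl_injective h')) hi hj
      rw [this]
    · exact ⟨0, fun i hi => absurd ⟨i, hi⟩ h⟩
  have hq : ∀ u, ∃ y, ∀ i, u ∈ D.Ω₂ i → y = D.c u * D.weight (rowOdd i) u := by
    intro u
    by_cases h : ∃ i, u ∈ D.Ω₂ i
    · obtain ⟨i, hi⟩ := h
      refine ⟨D.c u * D.weight (rowOdd i) u, fun j hj => ?_⟩
      have : i = j := by
        by_contra hne
        exact notMem_of_ne hdisj (s := Sum.inr i) (t := Sum.inr j)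
          (fun h' => hne (Sum.inr_injective h')) hi hj
      rw [this]
    · exact ⟨0, fun i hi => absurd ⟨i, hi⟩ h⟩
  choose p hp using hp
  choose q hq using hq
  refine ⟨p, q, fun u hu => ?_, fun v hv => ?_, fun u hu v hv => ?_, fun u hu v hv => ?_⟩
  · obtain ⟨i, hi⟩ := mem_iUnion.1 hu
    rw [hp u i hi]
    exact mul_ne_zero (hc0 _ (Or.inl hu)) (D.weight_ne_zero hw0 _ (Or.inl hu))
  · obtain ⟨i, hi⟩ := mem_iUnion.1 hv
    rw [hq v i hi]
    exact mul_ne_zero (hc0 _ (Or.inr hv)) (D.weight_ne_zero hw0 _ (Or.inr hv))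
  · obtain ⟨i, hi⟩ := mem_iUnion.1 hu
    obtain ⟨j, hj⟩ := mem_iUnion.1 hv
    have n1 := D.weight_ne_zero hw0 (rowEven i) (Or.inl hu)
    rw [H_eq, f_of_mem₁ hdisj hi, g_of_mem₂ hdisj hw0 hj, single_dotProduct, K₁_of_mem hdisj hi hj,
      hp u i hi, hq v j hj, M_eq]
    by_cases h : rowOdd i = rowOdd j
    · rw [h, Pi.single_eq_same, if_pos rfl]
      field_simp
    · rw [Pi.single_eq_of_ne h, if_neg h]
      simp
  · obtain ⟨i, hi⟩ := mem_iUnion.1 hu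
    obtain ⟨j, hj⟩ := mem_iUnion.1 hv
    have n1 := D.weight_ne_zero hw0 (rowOdd i) (Or.inr hu)
    rw [H_eq, f_of_mem₂ hdisj hi, g_of_mem₁ hdisj hw0 hj, single_dotProduct, K₂_of_mem hdisj hi hj,
      hp v j hj, hq u i hi, M_eq]
    by_cases h : rowEven i = rowEven j
    · rw [h, Pi.single_eq_same, if_pos rfl]
      field_simp
    · rw [Pi.single_eq_of_ne h, if_neg h]
      simp

end Values

end BlockData

/-! ### The measures of the discrete and the contour setting -/

/-- `S` is a countable union of measurable sets of finite `ν`-measure. -/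
def IsSigmaFiniteSet (ν : Measure ℂ) (S : Set ℂ) : Prop :=
  ∃ 𝒮 : Set (Set ℂ), 𝒮.Countable ∧ (∀ s ∈ 𝒮, MeasurableSet s ∧ ν s < ∞) ∧ S = ⋃₀ 𝒮

namespace IsSigmaFiniteSet

variable {ν : Measure ℂ}

theorem measurableSet {S : Set ℂ} (h : IsSigmaFiniteSet ν S) : MeasurableSet S := by
  obtain ⟨𝒮, hc, h𝒮, rfl⟩ := h
  exact MeasurableSet.sUnion hc fun s hs => (h𝒮 s hs).1

theorem iUnion {ι : Type*} [Countable ι] {S : ι → Set ℂ} (h : ∀ i, IsSigmaFiniteSet ν (S i)) :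
    IsSigmaFiniteSet ν (⋃ i, S i) := by
  choose 𝒮 hc h𝒮 hS using h
  refine ⟨⋃ i, 𝒮 i, countable_iUnion hc, fun s hs => ?_, ?_⟩
  · obtain ⟨i, hi⟩ := mem_iUnion.1 hs
    exact h𝒮 i s hi
  · rw [sUnion_iUnion]
    exact iUnion_congr hS

theorem union {S S' : Set ℂ} (h : IsSigmaFiniteSet ν S) (h' : IsSigmaFiniteSet ν S') :
    IsSigmaFiniteSet ν (S ∪ S') := by
  rw [union_eq_iUnion]
  exact iUnion fun b => by cases b <;> assumption

theorem sigmaFinite_restrict {S : Set ℂ} (h : IsSigmaFiniteSet ν S) :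
    SigmaFinite (ν.restrict S) := by
  have hm := h.measurableSet
  obtain ⟨𝒮, hc, h𝒮, hS⟩ := h
  refine Measure.sigmaFinite_of_countable (hc.insert Sᶜ) ?_ ?_
  · rintro s (rfl | hs)
    · rw [Measure.restrict_apply hm.compl]
      simp
    · exact (Measure.restrict_apply_le _ _).trans_lt (h𝒮 s hs).2
  · rw [sUnion_insert, ← hS, compl_union_self]

end IsSigmaFiniteSet

/-- A discrete subset of the plane is countable, by the Lindelöf property. -/
theorem IsDiscrete.isSigmaFiniteSet {S : Set ℂ} (h : IsDiscrete S) :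
    IsSigmaFiniteSet Measure.count S := by
  have := h.to_subtype
  have hS : S.Countable := countable_of_Lindelof_of_discrete.to_set
  refine ⟨(fun x => {x}) '' S, hS.image _, ?_, ?_⟩
  · rintro _ ⟨x, -, rfl⟩
    exact ⟨measurableSet_singleton x, by simp⟩
  · rw [sUnion_image, biUnion_of_singleton]

/-- An arc may have infinite length, but γ is Lipschitz on compact intervals, and countably many of
these cover J. -/
theorem isSigmaFiniteSet_image_ordConnected {J : Set ℝ} (hJ : J.OrdConnected) {γ : ℝ → ℂ}
    (hγ : ContDiffOn ℝ 1 γ J) : IsSigmaFiniteSet (Measure.hausdorffMeasure 1) (γ '' J) := by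
  -- Rational endpoints suffice, except at an endpoint that J contains.
  let C : Set ℝ := {x | x ∈ J ∧ (x ∈ range ((↑) : ℚ → ℝ) ∨ IsLeast J x ∨ IsGreatest J x)}
  have hC : C.Countable := by
    have h1 : {x | IsLeast J x}.Subsingleton := fun x hx y hy => hx.unique hy
    have h2 : {x | IsGreatest J x}.Subsingleton := fun x hx y hy => hx.unique hy
    refine ((countable_range ((↑) : ℚ → ℝ)).union (h1.countable.union h2.countable)).mono ?_
    exact fun x hx => hx.2
  have hlow : ∀ x ∈ J, ∃ a ∈ C, a ≤ x := by
    intro x hx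
    by_cases h : ∃ y ∈ J, y < x
    · obtain ⟨y, hy, hyx⟩ := h
      obtain ⟨q, hq1, hq2⟩ := exists_rat_btwn hyx
      exact ⟨q, ⟨hJ.out hy hx ⟨hq1.le, hq2.le⟩, Or.inl ⟨q, rfl⟩⟩, hq2.le⟩
    · push Not at h
      exact ⟨x, ⟨hx, Or.inr (Or.inl ⟨hx, h⟩)⟩, le_rfl⟩
  have hup : ∀ x ∈ J, ∃ b ∈ C, x ≤ b := by
    intro x hx
    by_cases h : ∃ y ∈ J, x < y
    · obtain ⟨y, hy, hyx⟩ := h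
      obtain ⟨q, hq1, hq2⟩ := exists_rat_btwn hyx
      exact ⟨q, ⟨hJ.out hx hy ⟨hq1.le, hq2.le⟩, Or.inl ⟨q, rfl⟩⟩, hq1.le⟩
    · push Not at h
      exact ⟨x, ⟨hx, Or.inr (Or.inr ⟨hx, h⟩)⟩, le_rfl⟩
  refine ⟨(fun p : ℝ × ℝ => γ '' Icc p.1 p.2) '' (C ×ˢ C), (hC.prod hC).image _, ?_, ?_⟩
  · rintro _ ⟨⟨a, b⟩, ⟨ha, hb⟩, rfl⟩
    have hsub : Icc a b ⊆ J := hJ.out ha.1 hb.1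
    have hγ' := hγ.mono hsub
    refine ⟨(isCompact_Icc.image_of_continuousOn hγ'.continuousOn).isClosed.measurableSet, ?_⟩
    obtain ⟨K, hK⟩ := hγ'.exists_lipschitzOnWith one_ne_zero (convex_Icc a b) isCompact_Icc
    refine (hK.hausdorffMeasure_image_le zero_le_one).trans_lt ?_
    rw [hausdorffMeasure_real, Real.volume_Icc]
    exact ENNReal.mul_lt_top (by simp) ENNReal.ofReal_lt_top
  · ext z
    simp only [mem_image, mem_sUnion]
    constructor
    · rintro ⟨x, hx, rfl⟩
      obtain ⟨a, ha, hax⟩ := hlow x hx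
      obtain ⟨b, hb, hxb⟩ := hup x hx
      exact ⟨_, ⟨(a, b), ⟨ha, hb⟩, rfl⟩, x, ⟨hax, hxb⟩, rfl⟩
    · rintro ⟨_, ⟨⟨a, b⟩, ⟨ha, hb⟩, rfl⟩, x, hx, rfl⟩
      exact ⟨x, hJ.out ha.1 hb.1 hx, rfl⟩

theorem IsContourUnion.isSigmaFiniteSet {τ : ℂ → ℂ} {S : Set ℂ} (h : IsContourUnion τ S) :
    IsSigmaFiniteSet (Measure.hausdorffMeasure 1) S := by
  obtain ⟨n, J, γ, hJ, rfl⟩ := h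
  exact IsSigmaFiniteSet.iUnion fun i =>
    isSigmaFiniteSet_image_ordConnected (hJ i).1 (hJ i).2.1

namespace BlockData

variable {m : ℕ} {D : BlockData m} {ρ : Measure ℂ} {τ : ℂ → ℂ}

theorem measurable_setting (hset : D.IsDiscreteSetting ρ τ ∨ D.IsContourSetting ρ τ) :
    (∀ j, MeasurableSet (D.Ω₁ j)) ∧ (∀ j, MeasurableSet (D.Ω₂ j)) ∧ SigmaFinite ρ ∧
      (∀ᵐ z ∂ρ, z ∈ D.Omega) ∧ Measurable τ := by
  have key : ∀ ν : Measure ℂ, (∀ j, IsSigmaFiniteSet ν (D.Ω₁ j)) →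
      (∀ j, IsSigmaFiniteSet ν (D.Ω₂ j)) → ρ = ν.restrict D.Omega →
      (∀ j, MeasurableSet (D.Ω₁ j)) ∧ (∀ j, MeasurableSet (D.Ω₂ j)) ∧ SigmaFinite ρ ∧
      (∀ᵐ z ∂ρ, z ∈ D.Omega) := by
    rintro ν h1 h2 rfl
    have hO : IsSigmaFiniteSet ν D.Omega := (IsSigmaFiniteSet.iUnion h1).union (.iUnion h2)
    exact ⟨fun j => (h1 j).measurableSet, fun j => (h2 j).measurableSet, hO.sigmaFinite_restrict,
      ae_restrict_mem hO.measurableSet⟩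
  rcases hset with ⟨h1, h2, hρ, rfl⟩ | ⟨hτ, -, h1, h2, hρ⟩
  · obtain ⟨k1, k2, k3, k4⟩ := key _ (fun j => (h1 j).isSigmaFiniteSet)
      (fun j => (h2 j).isSigmaFiniteSet) hρ
    exact ⟨k1, k2, k3, k4, measurable_const⟩
  · obtain ⟨k1, k2, k3, k4⟩ := key _ (fun j => (h1 j).isSigmaFiniteSet)
      (fun j => (h2 j).isSigmaFiniteSet) hρ
    exact ⟨k1, k2, k3, k4, hτ⟩

theorem aemeasurable_weight (hw : ∀ j, AEMeasurable (D.w j) ρ) (k : Fin (m + 1)) :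
    AEMeasurable (D.weight k) ρ := by
  by_cases h : (k : ℕ) < m
  · exact (hw ⟨k, h⟩).congr (.of_forall fun z => (D.weight_of_lt h z).symm)
  · exact aemeasurable_const.congr (.of_forall fun z => (D.weight_of_eq (by omega) z).symm)

theorem aemeasurable_mulVec {x : Fin m → ℂ → ℂ} (hx : ∀ j, AEMeasurable (x j) ρ)
    {S S' : Fin m → Set ℂ} (hS : ∀ j, MeasurableSet (S j)) (hS' : ∀ j, MeasurableSet (S' j))
    (k : Fin (m + 1)) : AEMeasurable (fun z => ((P m * L m) *ᵥ
      Sum.elim (fun j => x j z * (S j).indicator 1 z) (fun j => x j z * (S' j).indicator 1 z)) k)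
      ρ := by
  have h : ∀ (j : Fin m) {U : Set ℂ}, MeasurableSet U →
      AEMeasurable (fun z => x j z * U.indicator 1 z) ρ := fun j U hU =>
    (hx j).mul (measurable_one.indicator hU).aemeasurable
  simp only [Matrix.mulVec, dotProduct, Fintype.sum_sum_type, Sum.elim_inl, Sum.elim_inr]
  exact (Finset.aemeasurable_fun_sum _ fun j _ => (h j (hS j)).const_mul _).add
    (Finset.aemeasurable_fun_sum _ fun j _ => (h j (hS' j)).const_mul _)

theorem aemeasurable_H [SFinite ρ]
    (hS : ∀ j, MeasurableSet (D.Ω₁ j)) (hS' : ∀ j, MeasurableSet (D.Ω₂ j))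
    (hA : ∀ j, AEMeasurable (D.A j) ρ) (hB : ∀ j, AEMeasurable (D.B j) ρ)
    (hw : ∀ j, AEMeasurable (D.w j) ρ) (hc : AEMeasurable D.c ρ)
    (hw0 : ∀ j, ∀ z ∈ D.Omega, D.w j z ≠ 0) (hfull : ∀ᵐ z ∂ρ, z ∈ D.Omega) :
    AEMeasurable (Function.uncurry D.H) (ρ.prod ρ) := by
  have hf : ∀ k, AEMeasurable (fun z => D.f z k) ρ := by
    intro k
    simp only [f_apply]
    exact hc.mul ((aemeasurable_weight hw k).mul (aemeasurable_mulVec hA hS hS' k))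
  have hg : ∀ k, AEMeasurable (fun z => D.g z k) ρ := by
    intro k
    -- The matrix inverse in g is the diagonal of inverse weights where no weight vanishes, hence on
    -- Ω.
    refine (hc.inv.mul ((aemeasurable_weight hw k).inv.mul
      (aemeasurable_mulVec hB hS' hS k))).congr ?_
    filter_upwards [hfull] with z hz
    rw [D.g_apply hw0 hz]
    rfl
  have e : Function.uncurry D.H = fun p : ℂ × ℂ =>
      (∑ k, D.f p.1 k * D.g p.2 k) / (p.1 - p.2) := by
    ext p
    exact D.H_eq p.1 p.2
  rw [e]
  refine AEMeasurable.div (Finset.aemeasurable_fun_sum _ fun k _ => ?_)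
    (measurable_fst.sub measurable_snd).aemeasurable
  exact ((hf k).comp_quasiMeasurePreserving Measure.quasiMeasurePreserving_fst).mul
    ((hg k).comp_quasiMeasurePreserving Measure.quasiMeasurePreserving_snd)

end BlockData

/-- Fredholm series of kernels that are conjugate by a non-vanishing function agree. -/
theorem fredholmSeries_congr_of_conjugate {ρ : Measure ℂ} [SigmaFinite ρ] {τ : ℂ → ℂ}
    {K K' : ℂ → ℂ → ℂ} {S : Set ℂ} (hS : ∀ᵐ u ∂ρ, u ∈ S) {p : ℂ → ℂ} (hp : ∀ u ∈ S, p u ≠ 0)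
    (h : ∀ u ∈ S, ∀ w ∈ S, K' u w = p u * K u w / p w) :
    fredholmSeries ρ τ K' = fredholmSeries ρ τ K := by
  refine tsum_congr fun n => ?_
  rw [fredholmTerm, fredholmTerm]
  congr 1
  have hS' : ∀ᵐ x ∂(Measure.pi fun _ : Fin n => ρ), ∀ i, x i ∈ S :=
    ae_all_iff.2 fun i => (Measure.quasiMeasurePreserving_eval _ i).ae hS
  refine integral_congr_ae (hS'.mono fun x hx => ?_)
  rw [fredholmIntegrand, fredholmIntegrand]
  congr 1
  have e : (Matrix.of fun i j => K' (x i) (x j)) = Matrix.diagonal (fun i => p (x i)) *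
      (Matrix.of fun i j => K (x i) (x j)) * Matrix.diagonal fun i => (p (x i))⁻¹ := by
    ext i j
    rw [Matrix.mul_diagonal, Matrix.diagonal_mul, Matrix.of_apply, Matrix.of_apply,
      h _ (hx i) _ (hx j), div_eq_mul_inv]
  rw [e, Matrix.det_mul, Matrix.det_mul, Matrix.det_diagonal, Matrix.det_diagonal, mul_right_comm,
    ← Finset.prod_mul_distrib, Finset.prod_eq_one fun i _ => mul_inv_cancel₀ (hp _ (hx i)), one_mul]

/-! ### The determinant identity -/

theorem mainTheorem4 (m : ℕ) (hm : 1 ≤ m) (D : BlockData m)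
    (ρ : Measure ℂ) (τ : ℂ → ℂ)
    (hdisj : Pairwise (Function.onFun Disjoint (Sum.elim D.Ω₁ D.Ω₂)))
    (hset : D.IsDiscreteSetting ρ τ ∨ D.IsContourSetting ρ τ)
    (hA : ∀ j, AEMeasurable (D.A j) ρ) (hB : ∀ j, AEMeasurable (D.B j) ρ)
    (hw : ∀ j, AEMeasurable (D.w j) ρ) (hc : AEMeasurable D.c ρ)
    (hw0 : ∀ j, ∀ z ∈ D.Omega, D.w j z ≠ 0) (hc0 : ∀ z ∈ D.Omega, D.c z ≠ 0) :
    (∀ T : Lp ℂ 2 ρ →L[ℂ] Lp ℂ 2 ρ, IsIntegralOperator ρ τ D.H T → IsTraceClass T →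
      FredholmSeriesWellDefined (ρ.restrict D.Omega₁) τ
        (compKernel (ρ.restrict D.Omega₂) τ D.K₁ D.K₂) →
      HasFredholmDet T
        (fredholmSeries (ρ.restrict D.Omega₁) τ
          (compKernel (ρ.restrict D.Omega₂) τ D.K₁ D.K₂))) ∧
    ∀ z ∈ D.Omega, ∀ i, D.f z i * D.g z i = 0 := by
  refine ⟨fun T hT htr _ => ?_, fun z hz i => BlockData.f_mul_g_eq_zero hdisj hw0 hz i⟩
  obtain ⟨hS, hS', hσ, hfull, hτ⟩ := BlockData.measurable_setting hset
  have hD₁ : MeasurableSet D.Omega₁ := MeasurableSet.iUnion hS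
  have hD₂ : MeasurableSet D.Omega₂ := MeasurableSet.iUnion hS'
  have hdisj' : Disjoint D.Omega₁ D.Omega₂ := by
    refine disjoint_iUnion_left.2 fun i => disjoint_iUnion_right.2 fun j => ?_
    exact hdisj (i := Sum.inl i) (j := Sum.inr j) (by simp)
  have key := hasFredholmDet_of_off_diagonal hD₁ hD₂ hdisj' hfull
    (BlockData.aemeasurable_H hS hS' hA hB hw hc hw0 hfull) hτ.aemeasurable
    (fun u hu v hv => BlockData.H_eq_zero₁ hdisj hw0 hu hv)
    (fun u hu v hv => BlockData.H_eq_zero₂ hdisj hw0 hu hv) hT htr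
  obtain ⟨p, q, hp, hq, h12, h21⟩ := BlockData.exists_conjugation hdisj hw0 hc0
  -- In the composition of the two blocks q cancels under the integral, so the kernel is conjugate
  -- to that of K₁K₂ by p alone.
  rw [fredholmSeries_congr_of_conjugate (ae_restrict_mem hD₁) hp (K := compKernel
    (ρ.restrict D.Omega₂) τ D.K₁ D.K₂) fun u hu w hw' => ?_] at key
  · exact key
  · rw [compKernel, compKernel, ← integral_const_mul, ← integral_div]
    refine setIntegral_congr_fun hD₂ fun v hv => ?_
    have := hq v hv
    have := hp w hw'
    rw [h12 u hu v hv, h21 v hv w hw']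
    field_simp
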